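/- Conventions. A Fano polygon is a convex lattice polygon $P\subset\mathbb R^2$ whose vertices are primitive lattice points and which contains the origin in its interior. Its dual is $P^*=\{u\in\mathbb R^2:\langle u,v\rangle\ge -1\text{ for all }v\in P\}$, and $P$ is Kähler–Einstein (KE) if the barycenter of $P^*$ is the origin. An automorphism of $P$ is a matrix $\sigma\in GL_2(\mathbb Z)$ with $\sigma(P)=P$, and $P$ is symmetric if the origin is the only lattice point of $P$ fixed by all automorphisms of $P$. For a Fano polygon $P$, the B-transformation $B(P)$ is the convex hull of the barycenters of the cones over the edges of $P$; the barycenter of the cone over an edge with endpoints $v,v'$ is the primitive lattice point on the ray spanned by $v+v'$. The polygon $P$ is of type $B_m$ if $P,B(P),\dots,B^m(P)$ are all Fano polygons, and of type $B_\infty$ if it is of type $B_m$ for every positive integer $m$. It is $k$-periodic ($k\ge1$) if $B^{k+t}(P)=B^t(P)$ for some integer $t\ge 0$. Theorem. Let $P$ be a Fano polygon. 1. If $P$ is KE, then $P$ is of type $B_1$. If, moreover, $P$ is a triangle, then $B(P)=-P$, and $B^{2s}(P)=P$ and $B^{2s+1}(P)=-P$ for every integer $s\ge0$; hence $P$ is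 $2$-periodic and of type $B_\infty$, and every $B^s(P)$ ($s\ge 0$) is a KE Fano triangle. 2. If $P$ is symmetric, then $B(P)$ is a symmetric and KE Fano polygon, and $P$ is of type $B_\infty$. -/

import Mathlib

open scoped Pointwise

namespace FanoPolytope

noncomputable section

/-- The inclusion of the lattice `ℤⁿ` into `ℝⁿ`. -/
def latticeEmb {n : ℕ} (z : Fin n → ℤ) : Fin n → ℝ := fun i => (z i : ℝ)

/-- `v` is a lattice point of `ℝⁿ`. -/
def IsLatticePoint {n : ℕ} (v : Fin n → ℝ) : Prop := ∃ z : Fin n → ℤ, v = latticeEmb z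

/-- `v` is a primitive lattice point: the gcd of its (integer) coordinates is one. -/
def IsPrimitive {n : ℕ} (v : Fin n → ℝ) : Prop :=
  ∃ z : Fin n → ℤ, v = latticeEmb z ∧ Finset.univ.gcd z = 1

/-- The vertices of a polytope. -/
def vertices {n : ℕ} (P : Set (Fin n → ℝ)) : Set (Fin n → ℝ) := P.extremePoints ℝ

/-- A convex lattice polytope: the convex hull of finitely many lattice points. -/
def IsLatticePolytope {n : ℕ} (P : Set (Fin n → ℝ)) : Prop :=
  ∃ S : Finset (Fin n → ℤ), P = convexHull ℝ (latticeEmb '' (S : Set (Fin n → ℤ)))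

/-- A Fano polytope of dimension `n` in `ℝⁿ`: a lattice polytope with primitive vertices and with
the origin in its interior (so that it is full dimensional). -/
structure IsFano {n : ℕ} (P : Set (Fin n → ℝ)) : Prop where
  isLatticePolytope : IsLatticePolytope P
  zero_mem_interior : (0 : Fin n → ℝ) ∈ interior P
  primitive_vertices : ∀ v ∈ vertices P, IsPrimitive v

/-- The dual polytope `{u | ⟨u, v⟩ ≥ -1 for all v ∈ P}`. -/
def dual {n : ℕ} (P : Set (Fin n → ℝ)) : Set (Fin n → ℝ) := {u | ∀ v ∈ P, -1 ≤ u ⬝ᵥ v}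

/-- The barycenter (mean with respect to Lebesgue measure) of a convex body `K`. -/
def barycenter {n : ℕ} (K : Set (Fin n → ℝ)) : Fin n → ℝ :=
  (MeasureTheory.volume.real K)⁻¹ • ∫ x in K, x

/-- A Kähler-Einstein Fano polytope: its dual polytope has the origin as barycenter. -/
structure IsKahlerEinstein {n : ℕ} (P : Set (Fin n → ℝ)) : Prop where
  isFano : IsFano P
  barycenter_dual : barycenter (dual P) = 0

/-- The action of a unimodular matrix on `ℝⁿ`. -/
def unimodularMap {n : ℕ} (σ : GL (Fin n) ℤ) (x : Fin n → ℝ) : Fin n → ℝ :=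
  ((σ : Matrix (Fin n) (Fin n) ℤ).map (Int.cast : ℤ → ℝ)).mulVec x

/-- `σ` is an automorphism of `P`: a unimodular transformation mapping `P` onto itself. -/
def IsAutomorphism {n : ℕ} (P : Set (Fin n → ℝ)) (σ : GL (Fin n) ℤ) : Prop :=
  unimodularMap σ '' P = P

/-- A symmetric Fano polytope: the origin is the only lattice point of `P` that is fixed by every
automorphism of `P`. -/
structure IsSymmetric {n : ℕ} (P : Set (Fin n → ℝ)) : Prop where
  isFano : IsFano P
  eq_zero_of_fixed : ∀ v ∈ P, IsLatticePoint v →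
    (∀ σ : GL (Fin n) ℤ, IsAutomorphism P σ → unimodularMap σ v = v) → v = 0

/-- `F` is a facet of the `n`-dimensional polytope `P`: a face of dimension `n - 1`. -/
def IsFacet {n : ℕ} (P F : Set (Fin n → ℝ)) : Prop :=
  F.Nonempty ∧ IsExposed ℝ P F ∧ Module.finrank ℝ (vectorSpan ℝ F) + 1 = n

/-- `w` is the barycenter of the cone over the facet `F` of a Fano polytope. The primitive
generators of the rays of this cone are the vertices of `F`, and its barycenter is the primitive
lattice point on the ray spanned by their sum. -/
def IsConeBarycenter {n : ℕ} (F : Set (Fin n → ℝ)) (w : Fin n → ℝ) : Prop :=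
  IsPrimitive w ∧ ∃ c : ℝ, 0 < c ∧ ∑ᶠ v ∈ vertices F, v = c • w

/-- The barycentric transformation: the convex hull of the barycenters of all maximal
dimensional cones of `P`, i.e. of the cones over the facets of `P`. -/
def B {n : ℕ} (P : Set (Fin n → ℝ)) : Set (Fin n → ℝ) :=
  convexHull ℝ {w | ∃ F, IsFacet P F ∧ IsConeBarycenter F w}

/-- `P` is of type `B_m`: `B` can be applied `m` times with Fano results, i.e. `P`, `B(P)`, ...,
`B^m(P)` are Fano polytopes of the dimension of `P`. (`B` makes sense on Fano polytopes only, so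
that `B^m(P)` presupposes that the previous iterates are Fano.) -/
def IsOfType {n : ℕ} (m : ℕ) (P : Set (Fin n → ℝ)) : Prop := ∀ k ≤ m, IsFano (B^[k] P)

/-- `P` is of type `B_∞`: it is of type `B_m` for every positive integer `m`. -/
def IsOfTypeInfty {n : ℕ} (P : Set (Fin n → ℝ)) : Prop := ∀ m : ℕ, 0 < m → IsOfType m P

/-- `P` is `k`-periodic: `k ≥ 1` and `B^(k+t)(P) = B^t(P)` for some `t`. -/
def IsPeriodic {n : ℕ} (k : ℕ) (P : Set (Fin n → ℝ)) : Prop :=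
  1 ≤ k ∧ ∃ t : ℕ, B^[k + t] P = B^[t] P

/-- A polygon with exactly three vertices. -/
def IsTriangle (P : Set (Fin 2 → ℝ)) : Prop := (vertices P).ncard = 3

end

end FanoPolytope

namespace FanoPolytope

/-! ### Plane linear algebra -/

/-- The determinant of two vectors of the plane. -/
def cross (x y : Fin 2 → ℝ) : ℝ := x 0 * y 1 - x 1 * y 0

lemma dot_eq (u x : Fin 2 → ℝ) : u ⬝ᵥ x = u 0 * x 0 + u 1 * x 1 := by
  simp [dotProduct, Fin.sum_univ_two]

lemma cross_swap (x y : Fin 2 → ℝ) : cross y x = - cross x y := by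
  simp only [cross]; ring

lemma cross_self (x : Fin 2 → ℝ) : cross x x = 0 := by
  simp only [cross]; ring

lemma cross_relation (p v q : Fin 2 → ℝ) :
    cross v q • p + cross q p • v + cross p v • q = 0 := by
  ext i
  fin_cases i <;> simp [cross] <;> ring

lemma dot_cross_relation (u p v q : Fin 2 → ℝ) :
    cross v q * (u ⬝ᵥ p) + cross q p * (u ⬝ᵥ v) + cross p v * (u ⬝ᵥ q) = 0 := by
  simp only [dot_eq, cross]; ring

lemma exists_comb {v w : Fin 2 → ℝ} (h : cross v w ≠ 0) (x : Fin 2 → ℝ) :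
    ∃ a b : ℝ, x = a • v + b • w := by
  refine ⟨cross x w / cross v w, cross v x / cross v w, ?_⟩
  ext i
  fin_cases i <;> simp <;> field_simp <;> simp [cross] <;> ring

lemma exists_smul_of_cross_eq_zero {v x : Fin 2 → ℝ} (hv : v ≠ 0) (h : cross v x = 0) :
    ∃ c : ℝ, x = c • v := by
  have hn : v 0 ^ 2 + v 1 ^ 2 ≠ 0 := by
    intro h0
    apply hv
    ext i
    fin_cases i <;> simp <;> nlinarith [sq_nonneg (v 0), sq_nonneg (v 1)]
  refine ⟨(v 0 * x 0 + v 1 * x 1) / (v 0 ^ 2 + v 1 ^ 2), ?_⟩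
  simp only [cross] at h
  ext i
  fin_cases i
  · simp; field_simp; linear_combination (-v 1) * h
  · simp; field_simp; linear_combination (v 0) * h

lemma eq_zero_of_dot_eq_zero {v w u : Fin 2 → ℝ} (h : cross v w ≠ 0) (hv : u ⬝ᵥ v = 0)
    (hw : u ⬝ᵥ w = 0) : u = 0 := by
  simp only [dot_eq] at hv hw
  have h0 : u 0 * cross v w = 0 := by
    simp only [cross]; linear_combination w 1 * hv - v 1 * hw
  have h1 : u 1 * cross v w = 0 := by
    simp only [cross]; linear_combination v 0 * hw - w 0 * hv
  ext i
  fin_cases i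
  · simpa [h] using h0
  · simpa [h] using h1

lemma cross_eq_zero_of_dot_eq_zero {v w u : Fin 2 → ℝ} (h : u ≠ 0) (hv : u ⬝ᵥ v = 0)
    (hw : u ⬝ᵥ w = 0) : cross v w = 0 := by
  by_contra hc
  exact h (eq_zero_of_dot_eq_zero hc hv hw)

lemma exists_smul_of_dot_eq_zero {v x u : Fin 2 → ℝ} (h : u ≠ 0) (hv : v ≠ 0) (h1 : u ⬝ᵥ v = 0)
    (h2 : u ⬝ᵥ x = 0) : ∃ c : ℝ, x = c • v :=
  exists_smul_of_cross_eq_zero hv (cross_eq_zero_of_dot_eq_zero h h1 h2)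

/-- Functionals on the plane are given by dot products. -/
lemma exists_dot_eq (f : (Fin 2 → ℝ) →ₗ[ℝ] ℝ) : ∃ u : Fin 2 → ℝ, ∀ x, f x = u ⬝ᵥ x := by
  refine ⟨fun i => f (Pi.single i 1), fun x => ?_⟩
  rw [LinearMap.pi_apply_eq_sum_univ f x]
  simp only [dotProduct, smul_eq_mul]
  refine Finset.sum_congr rfl fun i _ => ?_
  rw [mul_comm]
  congr 2
  ext j
  simp [Pi.single_apply, eq_comm]

/-- The dot product with `u` as a linear functional. -/
noncomputable def dotL {n : ℕ} (u : Fin n → ℝ) : (Fin n → ℝ) →L[ℝ] ℝ :=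
  LinearMap.toContinuousLinearMap
    { toFun := fun x => u ⬝ᵥ x
      map_add' := fun x y => dotProduct_add u x y
      map_smul' := fun c x => dotProduct_smul c u x }

@[simp] lemma dotL_apply {n : ℕ} (u x : Fin n → ℝ) : dotL u x = u ⬝ᵥ x := rfl

/-! ### Lattice points -/

lemma IsLatticePoint.add {n : ℕ} {x y : Fin n → ℝ} (hx : IsLatticePoint x)
    (hy : IsLatticePoint y) : IsLatticePoint (x + y) := by
  obtain ⟨a, rfl⟩ := hx
  obtain ⟨b, rfl⟩ := hy
  exact ⟨a + b, by ext i; simp [latticeEmb]⟩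

lemma IsPrimitive.isLatticePoint {n : ℕ} {x : Fin n → ℝ} (hx : IsPrimitive x) :
    IsLatticePoint x := by
  obtain ⟨z, hz, -⟩ := hx
  exact ⟨z, hz⟩

/-- Primitivity is the existence of an integral functional with value one. -/
lemma isPrimitive_iff {n : ℕ} {x : Fin n → ℝ} :
    IsPrimitive x ↔ ∃ z c : Fin n → ℤ, x = latticeEmb z ∧ c ⬝ᵥ z = 1 := by
  constructor
  · rintro ⟨z, rfl, hz⟩
    obtain ⟨c, hc⟩ := Finset.gcd_eq_sum_mul Finset.univ z
    refine ⟨z, c, rfl, ?_⟩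
    rw [hz] at hc
    rw [hc, dotProduct]
    exact Finset.sum_congr rfl fun i _ => by ring
  · rintro ⟨z, c, rfl, hc⟩
    refine ⟨z, rfl, ?_⟩
    have h : Finset.univ.gcd z ∣ 1 := by
      rw [← hc]
      exact Finset.dvd_sum fun i hi => Dvd.dvd.mul_left (Finset.gcd_dvd hi) _
    have h2 := Finset.normalize_gcd (s := Finset.univ) (f := z)
    rw [← h2]
    exact normalize_eq_one.2 (isUnit_of_dvd_one h)

lemma IsPrimitive.neg {n : ℕ} {x : Fin n → ℝ} (hx : IsPrimitive x) : IsPrimitive (-x) := by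
  rw [isPrimitive_iff] at hx ⊢
  obtain ⟨z, c, rfl, h⟩ := hx
  exact ⟨-z, -c, by ext i; simp [latticeEmb], by simpa using h⟩

lemma IsPrimitive.ne_zero {n : ℕ} {x : Fin n → ℝ} (hx : IsPrimitive x) : x ≠ 0 := by
  rw [isPrimitive_iff] at hx
  obtain ⟨z, c, rfl, h⟩ := hx
  intro h0
  have : z = 0 := by
    ext i
    have := congrFun h0 i
    simpa [latticeEmb] using this
  simp [this] at h

lemma latticeEmb_dot {n : ℕ} (c z : Fin n → ℤ) :
    latticeEmb c ⬝ᵥ latticeEmb z = ((c ⬝ᵥ z : ℤ) : ℝ) := by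
  simp [dotProduct, latticeEmb]

lemma IsPrimitive.exists_int {n : ℕ} {w : Fin n → ℝ} (hw : IsPrimitive w) {c : ℝ}
    (h : IsLatticePoint (c • w)) : ∃ m : ℤ, c = m := by
  rw [isPrimitive_iff] at hw
  obtain ⟨z, d, rfl, hd⟩ := hw
  obtain ⟨y, hy⟩ := h
  refine ⟨d ⬝ᵥ y, ?_⟩
  rw [← latticeEmb_dot, ← hy, dotProduct_smul, latticeEmb_dot, hd]
  simp

lemma IsPrimitive.eq_of_smul {n : ℕ} {w w' : Fin n → ℝ} (hw : IsPrimitive w)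
    (hw' : IsPrimitive w') {c c' : ℝ} (hc : 0 < c) (hc' : 0 < c') (h : c • w = c' • w') :
    w = w' := by
  have h1 : w = (c' / c) • w' := by
    rw [div_eq_inv_mul, mul_smul, ← h, smul_smul, inv_mul_cancel₀ hc.ne', one_smul]
  have h2 : w' = (c / c') • w := by
    rw [div_eq_inv_mul, mul_smul, h, smul_smul, inv_mul_cancel₀ hc'.ne', one_smul]
  obtain ⟨m, hm⟩ := hw'.exists_int (c := c' / c) (h1 ▸ hw.isLatticePoint)
  obtain ⟨k, hk⟩ := hw.exists_int (c := c / c') (h2 ▸ hw'.isLatticePoint)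
  have hmk : m * k = 1 := by
    have : (m : ℝ) * k = 1 := by rw [← hm, ← hk]; field_simp
    exact_mod_cast this
  have hm0 : 0 < m := by
    have : (0 : ℝ) < m := by rw [← hm]; positivity
    exact_mod_cast this
  have : m = 1 := by
    rcases Int.eq_one_or_neg_one_of_mul_eq_one hmk with h | h <;> omega
  rw [h1, hm, this]; simp

lemma IsLatticePoint.exists_primitive {n : ℕ} {x : Fin n → ℝ} (hx : IsLatticePoint x)
    (h0 : x ≠ 0) : ∃ w, IsPrimitive w ∧ ∃ m : ℤ, 1 ≤ m ∧ x = (m : ℝ) • w := by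
  obtain ⟨z, rfl⟩ := hx
  obtain ⟨i, hi⟩ : ∃ i, z i ≠ 0 := by
    by_contra! h
    exact h0 (by ext i; simp [latticeEmb, h i])
  have hg : Finset.univ.gcd z ≠ 0 := by
    intro h
    exact hi (Finset.gcd_eq_zero_iff.1 h i (Finset.mem_univ i))
  have hg0 : 0 ≤ Finset.univ.gcd z := by
    rw [← Finset.normalize_gcd]
    exact Int.nonneg_of_normalize_eq_self (normalize_idem _)
  refine ⟨_, ⟨_, rfl, Finset.gcd_div_eq_one (Finset.mem_univ i) hi⟩, Finset.univ.gcd z, by omega, ?_⟩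
  ext j
  simp only [latticeEmb, Pi.smul_apply, smul_eq_mul]
  rw [← Int.cast_mul, Int.mul_ediv_cancel' (Finset.gcd_dvd (Finset.mem_univ j))]

/-! ### Unimodular maps -/

lemma unimodularMap_mul {n : ℕ} (σ τ : GL (Fin n) ℤ) (x : Fin n → ℝ) :
    unimodularMap (σ * τ) x = unimodularMap σ (unimodularMap τ x) := by
  have h := Matrix.map_mul (L := (σ : Matrix (Fin n) (Fin n) ℤ))
    (M := (τ : Matrix (Fin n) (Fin n) ℤ)) (f := Int.castRingHom ℝ)
  unfold unimodularMap
  rw [Matrix.mulVec_mulVec, Units.val_mul]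
  exact congrArg (fun M => Matrix.mulVec M x) h

lemma unimodularMap_one {n : ℕ} (x : Fin n → ℝ) : unimodularMap 1 x = x := by
  simp [unimodularMap]

@[simp] lemma unimodularMap_inv_apply {n : ℕ} (σ : GL (Fin n) ℤ) (x : Fin n → ℝ) :
    unimodularMap σ (unimodularMap σ⁻¹ x) = x := by
  rw [← unimodularMap_mul, mul_inv_cancel, unimodularMap_one]

@[simp] lemma unimodularMap_apply_inv {n : ℕ} (σ : GL (Fin n) ℤ) (x : Fin n → ℝ) :
    unimodularMap σ⁻¹ (unimodularMap σ x) = x := by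
  rw [← unimodularMap_mul, inv_mul_cancel, unimodularMap_one]

lemma unimodularMap_add {n : ℕ} (σ : GL (Fin n) ℤ) (x y : Fin n → ℝ) :
    unimodularMap σ (x + y) = unimodularMap σ x + unimodularMap σ y :=
  Matrix.mulVec_add _ x y

lemma unimodularMap_smul {n : ℕ} (σ : GL (Fin n) ℤ) (c : ℝ) (x : Fin n → ℝ) :
    unimodularMap σ (c • x) = c • unimodularMap σ x :=
  Matrix.mulVec_smul _ c x

/-- The linear automorphism of `ℝⁿ` given by a unimodular matrix. -/
noncomputable def unimodularEquiv {n : ℕ} (σ : GL (Fin n) ℤ) :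
    (Fin n → ℝ) ≃ₗ[ℝ] (Fin n → ℝ) where
  toFun := unimodularMap σ
  invFun := unimodularMap σ⁻¹
  map_add' := unimodularMap_add σ
  map_smul' := unimodularMap_smul σ
  left_inv x := by simp
  right_inv x := by simp

@[simp] lemma unimodularEquiv_apply {n : ℕ} (σ : GL (Fin n) ℤ) (x : Fin n → ℝ) :
    unimodularEquiv σ x = unimodularMap σ x := rfl

lemma unimodularMap_neg_one {n : ℕ} (x : Fin n → ℝ) : unimodularMap (-1) x = -x := by
  ext i
  simp [unimodularMap, Matrix.mulVec, dotProduct, Matrix.one_apply]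

lemma unimodularMap_latticeEmb {n : ℕ} (σ : GL (Fin n) ℤ) (z : Fin n → ℤ) :
    unimodularMap σ (latticeEmb z) = latticeEmb ((σ : Matrix (Fin n) (Fin n) ℤ).mulVec z) := by
  ext i
  simp [unimodularMap, latticeEmb, Matrix.mulVec, dotProduct]

lemma IsPrimitive.unimodularMap {n : ℕ} {x : Fin n → ℝ} (hx : IsPrimitive x)
    (σ : GL (Fin n) ℤ) : IsPrimitive (unimodularMap σ x) := by
  rw [isPrimitive_iff] at hx ⊢
  obtain ⟨z, c, rfl, h⟩ := hx
  refine ⟨_, Matrix.vecMul c ((σ⁻¹ : GL (Fin n) ℤ) : Matrix (Fin n) (Fin n) ℤ),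
    unimodularMap_latticeEmb σ z, ?_⟩
  rw [← Matrix.dotProduct_mulVec, Matrix.mulVec_mulVec, σ.inv_mul, Matrix.one_mulVec, h]

lemma IsLatticePoint.unimodularMap {n : ℕ} {x : Fin n → ℝ} (hx : IsLatticePoint x)
    (σ : GL (Fin n) ℤ) : IsLatticePoint (unimodularMap σ x) := by
  obtain ⟨z, rfl⟩ := hx
  exact ⟨_, unimodularMap_latticeEmb σ z⟩

/-- The action of a unimodular matrix on functionals. -/
noncomputable def dualMap {n : ℕ} (σ : GL (Fin n) ℤ) (u : Fin n → ℝ) : Fin n → ℝ :=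
  Matrix.vecMul u ((σ : Matrix (Fin n) (Fin n) ℤ).map (Int.cast : ℤ → ℝ))

lemma dualMap_dot {n : ℕ} (σ : GL (Fin n) ℤ) (u x : Fin n → ℝ) :
    dualMap σ u ⬝ᵥ x = u ⬝ᵥ unimodularMap σ x :=
  (Matrix.dotProduct_mulVec u _ x).symm

lemma eq_of_forall_dot_eq {n : ℕ} {u v : Fin n → ℝ} (h : ∀ x, u ⬝ᵥ x = v ⬝ᵥ x) : u = v := by
  ext i
  simpa using h (Pi.single i 1)

@[simp] lemma dualMap_inv_apply {n : ℕ} (σ : GL (Fin n) ℤ) (u : Fin n → ℝ) :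
    dualMap σ (dualMap σ⁻¹ u) = u :=
  eq_of_forall_dot_eq fun x => by simp [dualMap_dot]

@[simp] lemma dualMap_apply_inv {n : ℕ} (σ : GL (Fin n) ℤ) (u : Fin n → ℝ) :
    dualMap σ⁻¹ (dualMap σ u) = u :=
  eq_of_forall_dot_eq fun x => by simp [dualMap_dot]

/-- `dualMap` as a linear automorphism. -/
noncomputable def dualEquiv {n : ℕ} (σ : GL (Fin n) ℤ) : (Fin n → ℝ) ≃ₗ[ℝ] (Fin n → ℝ) where
  toFun := dualMap σ
  invFun := dualMap σ⁻¹
  map_add' u v := Matrix.add_vecMul _ u v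
  map_smul' c u := Matrix.smul_vecMul c u _
  left_inv u := by simp
  right_inv u := by simp

@[simp] lemma dualEquiv_apply {n : ℕ} (σ : GL (Fin n) ℤ) (u : Fin n → ℝ) :
    dualEquiv σ u = dualMap σ u := rfl

lemma IsAutomorphism.inv {n : ℕ} {P : Set (Fin n → ℝ)} {σ : GL (Fin n) ℤ}
    (h : IsAutomorphism P σ) : IsAutomorphism P σ⁻¹ := by
  unfold IsAutomorphism at *
  conv_lhs => rw [← h]
  rw [Set.image_image]
  simp

lemma IsAutomorphism.mem {n : ℕ} {P : Set (Fin n → ℝ)} {σ : GL (Fin n) ℤ}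
    (h : IsAutomorphism P σ) {x : Fin n → ℝ} (hx : x ∈ P) : unimodularMap σ x ∈ P :=
  h ▸ Set.mem_image_of_mem _ hx

lemma IsAutomorphism.mem_vertices {n : ℕ} {P : Set (Fin n → ℝ)} {σ : GL (Fin n) ℤ}
    (h : IsAutomorphism P σ) {x : Fin n → ℝ} (hx : x ∈ vertices P) :
    unimodularMap σ x ∈ vertices P := by
  have := image_extremePoints (𝕜 := ℝ) (unimodularEquiv σ) P
  have h2 : (unimodularEquiv σ : (Fin n → ℝ) → (Fin n → ℝ)) '' P = P := h
  rw [h2] at this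
  unfold vertices
  rw [← this]
  exact Set.mem_image_of_mem (unimodularEquiv σ) hx

lemma IsAutomorphism.dualMap_mem {n : ℕ} {P : Set (Fin n → ℝ)} {σ : GL (Fin n) ℤ}
    (h : IsAutomorphism P σ) {u : Fin n → ℝ} (hu : u ∈ dual P) : dualMap σ u ∈ dual P := by
  intro x hx
  rw [dualMap_dot]
  exact hu _ (h.mem hx)

/-! ### Fano polytopes -/

section Fano

variable {n : ℕ} {P : Set (Fin n → ℝ)}

lemma IsFano.convex (hP : IsFano P) : Convex ℝ P := by
  obtain ⟨S, rfl⟩ := hP.isLatticePolytope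
  exact convex_convexHull ℝ _

lemma IsFano.isCompact (hP : IsFano P) : IsCompact P := by
  obtain ⟨S, rfl⟩ := hP.isLatticePolytope
  exact (S.finite_toSet.image _).isCompact_convexHull ℝ

lemma IsFano.finite_vertices (hP : IsFano P) : (vertices P).Finite := by
  obtain ⟨S, rfl⟩ := hP.isLatticePolytope
  exact (S.finite_toSet.image _).subset extremePoints_convexHull_subset

lemma IsFano.eq_convexHull (hP : IsFano P) : P = convexHull ℝ (vertices P) := by
  conv_lhs => rw [← closure_convexHull_extremePoints hP.isCompact hP.convex]
  exact (hP.finite_vertices.isClosed_convexHull ℝ).closure_eq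

lemma IsFano.zero_mem (hP : IsFano P) : (0 : Fin n → ℝ) ∈ P :=
  interior_subset hP.zero_mem_interior

lemma vertices_subset : vertices P ⊆ P := extremePoints_subset

lemma IsFano.le_dot (hP : IsFano P) {u : Fin n → ℝ} {c : ℝ}
    (h : ∀ v ∈ vertices P, c ≤ u ⬝ᵥ v) {x : Fin n → ℝ} (hx : x ∈ P) : c ≤ u ⬝ᵥ x := by
  rw [hP.eq_convexHull] at hx
  have hc : Convex ℝ {x | c ≤ dotL u x} :=
    convex_halfSpace_ge (dotL u).toLinearMap.isLinear c
  exact convexHull_min (fun v hv => h v hv) hc hx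

lemma IsFano.mem_dual (hP : IsFano P) {u : Fin n → ℝ} :
    u ∈ dual P ↔ ∀ v ∈ vertices P, -1 ≤ u ⬝ᵥ v :=
  ⟨fun h v hv => h v (vertices_subset hv), fun h _ hx => hP.le_dot h hx⟩

lemma exists_smul_mem (h : (0 : Fin n → ℝ) ∈ interior P) (x : Fin n → ℝ) :
    ∃ ε : ℝ, 0 < ε ∧ ε • x ∈ P := by
  have h1 : Filter.Tendsto (fun t : ℝ => t • x) (nhds 0) (nhds 0) := by
    have : Continuous fun t : ℝ => t • x := by fun_prop
    simpa using this.tendsto 0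
  have h2 : ∀ᶠ t in nhds (0 : ℝ), t • x ∈ P := h1.eventually (mem_interior_iff_mem_nhds.1 h)
  obtain ⟨ε, hε, h3⟩ := Metric.eventually_nhds_iff.1 h2
  refine ⟨ε / 2, by positivity, h3 ?_⟩
  simp [abs_of_pos hε, hε]

lemma IsFano.exists_vertex_neg (hP : IsFano P) {u : Fin n → ℝ} (hu : u ≠ 0) :
    ∃ v ∈ vertices P, u ⬝ᵥ v < 0 := by
  by_contra! h
  obtain ⟨ε, hε, h2⟩ := exists_smul_mem hP.zero_mem_interior (-u)
  have h3 := hP.le_dot h h2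
  rw [dotProduct_smul, dotProduct_neg, smul_eq_mul] at h3
  have h4 : 0 < u ⬝ᵥ u :=
    lt_of_le_of_ne (Finset.sum_nonneg fun i _ => mul_self_nonneg _)
      (fun h => hu (dotProduct_self_eq_zero.1 h.symm))
  nlinarith

lemma IsFano.exists_vertex_pos (hP : IsFano P) {u : Fin n → ℝ} (hu : u ≠ 0) :
    ∃ v ∈ vertices P, 0 < u ⬝ᵥ v := by
  obtain ⟨v, hv, h⟩ := hP.exists_vertex_neg (neg_ne_zero.2 hu)
  exact ⟨v, hv, by simpa using h⟩

lemma IsFano.vertex_ne_zero (hP : IsFano P) {v : Fin n → ℝ} (hv : v ∈ vertices P) : v ≠ 0 :=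
  (hP.primitive_vertices v hv).ne_zero

lemma eq_of_vertex_comb {v x y : Fin n → ℝ} (hv : v ∈ vertices P) (hx : x ∈ P) (hy : y ∈ P)
    {t : ℝ} (h0 : 0 < t) (h1 : t < 1) (h : v = (1 - t) • x + t • y) : x = v ∧ y = v :=
  (mem_extremePoints.1 hv).2 x hx y hy ⟨1 - t, t, by linarith, h0, by ring, h.symm⟩

lemma IsFano.le_one_of_smul_mem (hP : IsFano P) {v : Fin n → ℝ} (hv : v ∈ vertices P) {a : ℝ}
    (h : a • v ∈ P) : a ≤ 1 := by
  by_contra! ha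
  have h0 := hP.vertex_ne_zero hv
  have := (eq_of_vertex_comb (t := 1 / a) hv hP.zero_mem h (by positivity)
    (by rw [div_lt_one (by linarith)]; exact ha)
    (by rw [smul_zero, zero_add, smul_smul, one_div_mul_cancel (by linarith), one_smul])).1
  exact h0 this.symm

lemma dual_closed : IsClosed (dual P) := by
  have : dual P = ⋂ v ∈ P, {u | -1 ≤ u ⬝ᵥ v} := by
    ext u; simp [dual]
  rw [this]
  refine isClosed_biInter fun v _ => isClosed_le continuous_const ?_
  simp only [dotProduct_comm _ v]
  exact (dotL v).continuous

lemma dual_convex : Convex ℝ (dual P) := by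
  intro u hu w hw a b ha hb hab x hx
  rw [add_dotProduct, smul_dotProduct, smul_dotProduct, smul_eq_mul, smul_eq_mul]
  nlinarith [hu x hx, hw x hx]

lemma IsFano.dual_bounded (hP : IsFano P) : Bornology.IsBounded (dual P) := by
  have h : ∀ i, ∃ C : ℝ, ∀ u ∈ dual P, |u i| ≤ C := by
    intro i
    obtain ⟨ε, hε, h1⟩ := exists_smul_mem hP.zero_mem_interior (Pi.single i 1)
    obtain ⟨δ, hδ, h2⟩ := exists_smul_mem hP.zero_mem_interior (-Pi.single i 1)
    refine ⟨max (1 / ε) (1 / δ), fun u hu => abs_le.2 ⟨?_, ?_⟩⟩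
    · have := hu _ h1
      simp only [dotProduct_smul, dotProduct_single, mul_one, smul_eq_mul] at this
      have h3 : -(1 / ε) ≤ u i := by
        rw [← neg_div, div_le_iff₀ hε]; linarith
      linarith [le_max_left (1 / ε) (1 / δ)]
    · have := hu _ h2
      simp only [dotProduct_smul, dotProduct_neg, dotProduct_single, mul_one, smul_eq_mul] at this
      have h3 : u i ≤ 1 / δ := by
        rw [le_div_iff₀ hδ]; linarith
      linarith [le_max_right (1 / ε) (1 / δ)]
  choose C hC using h
  rw [isBounded_iff_forall_norm_le]
  refine ⟨∑ i, |C i|, fun u hu => (pi_norm_le_iff_of_nonneg (by positivity)).2 fun i => ?_⟩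
  rw [Real.norm_eq_abs]
  exact ((hC i u hu).trans (le_abs_self _)).trans
    (Finset.single_le_sum (f := fun i => |C i|) (fun _ _ => abs_nonneg _) (Finset.mem_univ i))

lemma IsFano.zero_mem_interior_dual (hP : IsFano P) : (0 : Fin n → ℝ) ∈ interior (dual P) := by
  have h : (⋂ v ∈ vertices P, {u : Fin n → ℝ | -1 < u ⬝ᵥ v}) ⊆ dual P := by
    intro u hu
    rw [hP.mem_dual]
    intro v hv
    simp only [Set.mem_iInter, Set.mem_ofPred_eq] at hu
    exact (hu v hv).le
  refine mem_interior.2 ⟨_, h, ?_, by simp⟩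
  refine hP.finite_vertices.isOpen_biInter fun v _ => isOpen_lt continuous_const ?_
  simp only [dotProduct_comm _ v]
  exact (dotL v).continuous

end Fano

/-! ### Edges of Fano polygons -/

variable {P : Set (Fin 2 → ℝ)}

/-- `p` and `q` are the endpoints of an edge of `P`. -/
def IsEdge (P : Set (Fin 2 → ℝ)) (p q : Fin 2 → ℝ) : Prop :=
  p ∈ vertices P ∧ q ∈ vertices P ∧ p ≠ q ∧ ∃ u ∈ dual P, u ⬝ᵥ p = -1 ∧ u ⬝ᵥ q = -1

lemma IsEdge.symm {p q : Fin 2 → ℝ} (h : IsEdge P p q) : IsEdge P q p := by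
  obtain ⟨hp, hq, hpq, u, hu, h1, h2⟩ := h
  exact ⟨hq, hp, hpq.symm, u, hu, h2, h1⟩

lemma IsEdge.add_ne_zero {p q : Fin 2 → ℝ} (h : IsEdge P p q) : p + q ≠ 0 := by
  obtain ⟨hp, hq, hpq, u, hu, h1, h2⟩ := h
  intro h0
  have := congrArg (fun x => u ⬝ᵥ x) h0
  simp only [dotProduct_add, dotProduct_zero, h1, h2] at this
  norm_num at this

lemma eq_or_eq_of_dot_eq {u x y z : Fin 2 → ℝ} (hu : u ≠ 0) (hx : x ∈ vertices P)
    (hy : y ∈ vertices P) (hz : z ∈ vertices P) (hxy : x ≠ y) (h1 : u ⬝ᵥ x = u ⬝ᵥ y)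
    (h2 : u ⬝ᵥ x = u ⬝ᵥ z) : z = x ∨ z = y := by
  by_contra! hc
  obtain ⟨hzx, hzy⟩ := hc
  obtain ⟨c, hc⟩ := exists_smul_of_dot_eq_zero (v := y - x) (x := z - x) hu
    (sub_ne_zero.2 hxy.symm) (by rw [dotProduct_sub]; linarith) (by rw [dotProduct_sub]; linarith)
  have hzc : z = x + c • (y - x) := by rw [← hc]; abel
  have hc0 : c ≠ 0 := by rintro rfl; simp at hzc; exact hzx hzc
  have hc1 : c ≠ 1 := by rintro rfl; simp at hzc; exact hzy hzc
  have hxP := vertices_subset hx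
  have hyP := vertices_subset hy
  have hzP := vertices_subset hz
  rcases lt_trichotomy c 0 with h | h | h
  · refine hzx (eq_of_vertex_comb (t := -c / (1 - c)) hx hzP hyP
      (div_pos (by linarith) (by linarith)) (by rw [div_lt_one] <;> linarith) ?_).1
    have : 1 - c ≠ 0 := by linarith
    rw [hzc]
    ext i
    simp; field_simp; ring
  · exact hc0 h
  · rcases lt_or_gt_of_ne hc1 with h' | h'
    · refine hzx (eq_of_vertex_comb (t := c) hz hxP hyP h h' ?_).1.symm
      rw [hzc]; ext i; simp; ring
    · refine hxy (eq_of_vertex_comb (t := 1 / c) hy hxP hzP (by positivity)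
        (by rw [div_lt_one] <;> linarith) ?_).1
      rw [hzc]; ext i; simp; field_simp; ring

lemma ne_zero_of_dot_eq_neg_one {u x : Fin 2 → ℝ} (h : u ⬝ᵥ x = -1) : u ≠ 0 := by
  rintro rfl; simp at h

lemma isExposed_of_mem_dual {u : Fin 2 → ℝ} (hu : u ∈ dual P) {p : Fin 2 → ℝ} (hp : p ∈ P)
    (hup : u ⬝ᵥ p = -1) : IsExposed ℝ P {x ∈ P | u ⬝ᵥ x = -1} := by
  intro _
  refine ⟨-dotL u, ?_⟩
  ext x
  simp only [Set.mem_sep_iff, neg_apply, dotL_apply, neg_le_neg_iff]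
  refine and_congr_right fun hx => ⟨fun h y hy => h ▸ hu y hy, fun h => ?_⟩
  exact le_antisymm (hup ▸ h p hp) (hu x hx)

lemma vertices_face {u p q : Fin 2 → ℝ} (hu : u ∈ dual P)
    (hp : p ∈ vertices P) (hq : q ∈ vertices P) (hpq : p ≠ q) (hup : u ⬝ᵥ p = -1)
    (huq : u ⬝ᵥ q = -1) : vertices {x ∈ P | u ⬝ᵥ x = -1} = {p, q} := by
  unfold vertices
  rw [(isExposed_of_mem_dual hu (vertices_subset hp) hup).isExtreme.extremePoints_eq]
  ext x
  simp only [Set.mem_inter_iff, Set.mem_sep_iff, Set.mem_insert_iff, Set.mem_singleton_iff]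
  constructor
  · rintro ⟨⟨hx, hux⟩, hxv⟩
    exact eq_or_eq_of_dot_eq (ne_zero_of_dot_eq_neg_one hup) hp hq hxv hpq
      (by rw [hup, huq]) (by rw [hup, hux])
  · rintro (rfl | rfl)
    · exact ⟨⟨vertices_subset hp, hup⟩, hp⟩
    · exact ⟨⟨vertices_subset hq, huq⟩, hq⟩

lemma IsEdge.exists_facet {p q : Fin 2 → ℝ} (h : IsEdge P p q) :
    ∃ F, IsFacet P F ∧ vertices F = {p, q} := by
  obtain ⟨hp, hq, hpq, u, hu, h1, h2⟩ := h
  refine ⟨{x ∈ P | u ⬝ᵥ x = -1}, ⟨⟨p, vertices_subset hp, h1⟩,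
    isExposed_of_mem_dual hu (vertices_subset hp) h1, ?_⟩, vertices_face hu hp hq hpq h1 h2⟩
  have hspan : vectorSpan ℝ {x ∈ P | u ⬝ᵥ x = -1} = Submodule.span ℝ {q - p} := by
    apply le_antisymm
    · rw [vectorSpan_def, Submodule.span_le]
      rintro _ ⟨x, ⟨-, hx⟩, y, ⟨-, hy⟩, rfl⟩
      obtain ⟨c, hc⟩ := exists_smul_of_dot_eq_zero (v := q - p) (x := x - y)
        (ne_zero_of_dot_eq_neg_one h1) (sub_ne_zero.2 hpq.symm)
        (by rw [dotProduct_sub, h1, h2, sub_self]) (by rw [dotProduct_sub, hx, hy, sub_self])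
      exact Submodule.mem_span_singleton.2 ⟨c, hc.symm⟩
    · rw [Submodule.span_singleton_le_iff_mem]
      exact vsub_mem_vectorSpan ℝ ⟨vertices_subset hq, h2⟩ ⟨vertices_subset hp, h1⟩
  rw [hspan, finrank_span_singleton (sub_ne_zero.2 hpq.symm)]

lemma IsFano.isEdge_of_isFacet (hP : IsFano P) {F : Set (Fin 2 → ℝ)} (hF : IsFacet P F) :
    ∃ p q, IsEdge P p q ∧ vertices F = {p, q} := by
  obtain ⟨hne, hexp, hrank⟩ := hF
  obtain ⟨l, hl⟩ := hexp hne
  obtain ⟨u, hu⟩ := exists_dot_eq l.toLinearMap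
  replace hu : ∀ x, l x = u ⬝ᵥ x := hu
  have hu0 : u ≠ 0 := by
    rintro rfl
    have hFP : F = P := by
      rw [hl]; ext x; simp [hu]
    have h1 : affineSpan ℝ P = ⊤ :=
      hP.convex.interior_nonempty_iff_affineSpan_eq_top.1 ⟨0, hP.zero_mem_interior⟩
    have h2 : vectorSpan ℝ P = ⊤ := by
      rw [← direction_affineSpan, h1, AffineSubspace.direction_top]
    rw [hFP, h2, finrank_top] at hrank
    simp at hrank
  obtain ⟨a, ha⟩ := hne
  have ha' := ha
  rw [hl] at ha'
  obtain ⟨haP, hmax⟩ := ha'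
  simp only [hu] at hmax
  have hM : 0 < u ⬝ᵥ a := by
    obtain ⟨v, hv, h⟩ := hP.exists_vertex_pos hu0
    exact h.trans_le (hmax v (vertices_subset hv))
  set u' := -((u ⬝ᵥ a)⁻¹ • u) with hu'
  have hdot : ∀ x, u' ⬝ᵥ x = -(u ⬝ᵥ x / (u ⬝ᵥ a)) := by
    intro x
    rw [hu', neg_dotProduct, smul_dotProduct, smul_eq_mul, div_eq_inv_mul]
  have hu'P : u' ∈ dual P := by
    intro x hx
    rw [hdot, neg_le_neg_iff, div_le_one hM]
    exact hmax x hx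
  have hFeq : F = {x ∈ P | u' ⬝ᵥ x = -1} := by
    rw [hl]
    ext x
    simp only [Set.mem_sep_iff, hu, hdot, neg_inj, div_eq_one_iff_eq hM.ne']
    refine and_congr_right fun hx => ⟨fun h => le_antisymm (hmax x hx) (h a haP), fun h y hy => ?_⟩
    rw [h]; exact hmax y hy
  have hverts : vertices F = F ∩ vertices P := hexp.isExtreme.extremePoints_eq
  have hnt : (vertices F).Nontrivial := by
    by_contra hsub
    rw [Set.not_nontrivial_iff] at hsub
    have hcl := closure_convexHull_extremePoints (hexp.isCompact hP.isCompact) (hexp.convex hP.convex)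
    have hFs : F.Subsingleton := by
      rcases hsub.eq_empty_or_singleton with h | ⟨b, h⟩
      · unfold vertices at h
        rw [h] at hcl; simp at hcl
        rw [← hcl]; exact Set.subsingleton_empty
      · unfold vertices at h
        rw [h] at hcl; simp at hcl
        rw [← hcl]; exact Set.subsingleton_singleton
    rw [vectorSpan_of_subsingleton ℝ hFs] at hrank
    simp at hrank
  obtain ⟨p, hp, q, hq, hpq⟩ := hnt
  rw [hverts, hFeq] at hp hq
  refine ⟨p, q, ⟨hp.2, hq.2, hpq, u', hu'P, hp.1.2, hq.1.2⟩, ?_⟩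
  rw [hFeq]
  exact vertices_face hu'P hp.2 hq.2 hpq hp.1.2 hq.1.2

/-- The barycenters of the cones over the edges of `P`. -/
def coneBarycenters (P : Set (Fin 2 → ℝ)) : Set (Fin 2 → ℝ) :=
  {w | IsPrimitive w ∧ ∃ p q, IsEdge P p q ∧ ∃ c : ℝ, 0 < c ∧ p + q = c • w}

lemma IsFano.B_eq (hP : IsFano P) : B P = convexHull ℝ (coneBarycenters P) := by
  unfold B
  congr 1
  ext w
  constructor
  · rintro ⟨F, hF, hw, c, hc, h⟩
    obtain ⟨p, q, hpq, hv⟩ := hP.isEdge_of_isFacet hF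
    rw [hv, finsum_mem_pair hpq.2.2.1] at h
    exact ⟨hw, p, q, hpq, c, hc, h⟩
  · rintro ⟨hw, p, q, hpq, c, hc, h⟩
    obtain ⟨F, hF, hv⟩ := hpq.exists_facet
    refine ⟨F, hF, hw, c, hc, ?_⟩
    rw [hv, finsum_mem_pair hpq.2.2.1, h]

lemma IsFano.isLatticePoint_vertex (hP : IsFano P) {v : Fin 2 → ℝ} (hv : v ∈ vertices P) :
    IsLatticePoint v :=
  (hP.primitive_vertices v hv).isLatticePoint

lemma IsFano.exists_coneBarycenter (hP : IsFano P) {p q : Fin 2 → ℝ} (h : IsEdge P p q) :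
    ∃ w ∈ coneBarycenters P, ∃ c : ℝ, 0 < c ∧ p + q = c • w := by
  obtain ⟨w, hw, m, hm, hpq⟩ := ((hP.isLatticePoint_vertex h.1).add
    (hP.isLatticePoint_vertex h.2.1)).exists_primitive h.add_ne_zero
  have hm0 : (0 : ℝ) < m := by exact_mod_cast (by omega : 0 < m)
  exact ⟨w, ⟨hw, p, q, h, m, hm0, hpq⟩, m, hm0, hpq⟩

lemma IsFano.finite_coneBarycenters (hP : IsFano P) : (coneBarycenters P).Finite := by
  have hfin := hP.finite_vertices.prod hP.finite_vertices
  refine (hfin.biUnion (t := fun x => {w | IsPrimitive w ∧ ∃ c : ℝ, 0 < c ∧ x.1 + x.2 = c • w})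
    fun x _ => Set.Subsingleton.finite ?_).subset ?_
  · rintro w ⟨hw, c, hc, h⟩ w' ⟨hw', c', hc', h'⟩
    exact hw.eq_of_smul hw' hc hc' (h.symm.trans h')
  · rintro w ⟨hw, p, q, hpq, c, hc, h⟩
    simp only [Set.mem_iUnion]
    exact ⟨(p, q), ⟨hpq.1, hpq.2.1⟩, hw, c, hc, h⟩

lemma IsFano.B_isFano (hP : IsFano P) (h0 : (0 : Fin 2 → ℝ) ∈ interior (B P)) :
    IsFano (B P) := by
  have hemb : Function.Injective (latticeEmb (n := 2)) := by
    intro x y h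
    ext i
    have := congrFun h i
    simpa [latticeEmb] using this
  refine ⟨⟨(hP.finite_coneBarycenters.preimage hemb.injOn).toFinset, ?_⟩, h0, fun v hv => ?_⟩
  · rw [hP.B_eq, Set.Finite.coe_toFinset, Set.image_preimage_eq_of_subset]
    rintro w ⟨⟨z, hz, -⟩, -⟩
    exact ⟨z, hz.symm⟩
  · rw [hP.B_eq] at hv
    exact (extremePoints_convexHull_subset hv).1

lemma zero_mem_interior_convexHull {S : Set (Fin 2 → ℝ)}
    (h : ∀ u : Fin 2 → ℝ, (∀ w ∈ S, 0 ≤ u ⬝ᵥ w) → u = 0) :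
    (0 : Fin 2 → ℝ) ∈ interior (convexHull ℝ S) := by
  by_contra hn
  have hint : (interior (convexHull ℝ S)).Nonempty := by
    rw [interior_convexHull_nonempty_iff_affineSpan_eq_top]
    have hSne : S.Nonempty := by
      by_contra hS
      rw [Set.not_nonempty_iff_eq_empty] at hS
      have := congrFun (h (fun _ => 1) (by simp [hS])) 0
      norm_num at this
    obtain ⟨a, ha⟩ := hSne
    by_contra hne
    have hv : vectorSpan ℝ S < ⊤ := by
      refine lt_of_le_of_ne le_top fun h' => hne ?_
      exact (AffineSubspace.affineSpan_eq_top_iff_vectorSpan_eq_top_of_nonempty ℝ _ _ ⟨a, ha⟩).2 h'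
    obtain ⟨f, hf0, hf⟩ := Submodule.exists_le_ker_of_lt_top _ hv
    obtain ⟨u, hu⟩ := exists_dot_eq f
    have hconst : ∀ w ∈ S, u ⬝ᵥ w = u ⬝ᵥ a := by
      intro w hw
      have : f (w - a) = 0 := hf (vsub_mem_vectorSpan ℝ hw ha)
      rw [hu, dotProduct_sub] at this
      linarith
    have hu0 : u = 0 := by
      rcases le_total 0 (u ⬝ᵥ a) with h0 | h0
      · exact h u fun w hw => by rw [hconst w hw]; exact h0
      · refine neg_eq_zero.1 (h (-u) fun w hw => ?_)
        rw [neg_dotProduct, hconst w hw]; linarith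
    exact hf0 (LinearMap.ext fun x => by rw [hu, hu0]; simp)
  obtain ⟨f, hf0, hf⟩ := geometric_hahn_banach_of_nonempty_interior_point
    (convex_convexHull ℝ S) hn hint
  obtain ⟨u, hu⟩ := exists_dot_eq f.toLinearMap
  replace hu : ∀ x, f x = u ⬝ᵥ x := hu
  have : -u = 0 := h _ fun w hw => by
    have := hf w (subset_convexHull ℝ S hw)
    rw [map_zero, hu] at this
    rw [neg_dotProduct]; linarith
  exact hf0 (ContinuousLinearMap.ext fun x => by rw [hu, neg_eq_zero.1 this]; simp)

/-- Every vertex has an edge on each of its two sides. -/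
lemma IsFano.exists_edge (hP : IsFano P) {v : Fin 2 → ℝ} (hv : v ∈ vertices P) {ε : ℝ}
    (hε : ε ≠ 0) : ∃ q, IsEdge P v q ∧ 0 < ε * cross v q := by
  have hv0 := hP.vertex_ne_zero hv
  have hN : 0 < v ⬝ᵥ v :=
    lt_of_le_of_ne (Finset.sum_nonneg fun i _ => mul_self_nonneg _)
      (fun h => hv0 (dotProduct_self_eq_zero.1 h.symm))
  set N := v ⬝ᵥ v with hNdef
  set a : (Fin 2 → ℝ) → ℝ := fun x => (v ⬝ᵥ x) / N with ha
  set b : (Fin 2 → ℝ) → ℝ := fun x => ε * cross v x with hb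
  set m : Fin 2 → ℝ := ![-(ε * v 1), ε * v 0] with hm
  have hmb : ∀ x, m ⬝ᵥ x = b x := by
    intro x; simp only [dot_eq, hm, hb, cross]; simp; ring
  have hN' : N = v 0 * v 0 + v 1 * v 1 := by rw [hNdef, dot_eq]
  have hm0 : m ≠ 0 := by
    intro h
    have h0 := congrFun h 0
    have h1 := congrFun h 1
    simp [hm, hε] at h0 h1
    rw [hN', h0, h1] at hN
    simp at hN
  have hkey : ∀ x y, b y • x - b x • y = (b y * a x - b x * a y) • v := by
    intro x y
    have hNne : v 0 ^ 2 + v 1 ^ 2 ≠ 0 := by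
      rw [hN'] at hN; nlinarith
    ext i
    simp only [ha, hb, dot_eq, hN', cross]
    fin_cases i <;> simp <;> field_simp <;> ring
  have hle : ∀ y ∈ vertices P, b y = 0 → a y ≤ 1 := by
    intro y hy hby
    obtain ⟨z, hz, hbz⟩ := hP.exists_vertex_pos hm0
    rw [hmb] at hbz
    have := hkey y z
    rw [hby, zero_smul, sub_zero, zero_mul, sub_zero, ← smul_smul (b z) (a y)] at this
    have h2 := smul_right_injective _ hbz.ne' this
    exact hP.le_one_of_smul_mem hv (h2 ▸ vertices_subset hy)
  have hcmp : ∀ y ∈ vertices P, ∀ q ∈ vertices P, b y < 0 → 0 < b q →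
      b q * a y - b y * a q ≤ b q - b y := by
    intro y hy q hq hby hbq
    have hpos : 0 < b q - b y := by linarith
    have hmem : (b q / (b q - b y)) • y + (-b y / (b q - b y)) • q ∈ P :=
      hP.convex (vertices_subset hy) (vertices_subset hq) (by positivity)
        (div_nonneg (by linarith) hpos.le) (by field_simp; ring)
    have heq : (b q / (b q - b y)) • y + (-b y / (b q - b y)) • q
        = ((b q * a y - b y * a q) / (b q - b y)) • v := by
      rw [div_eq_inv_mul, div_eq_inv_mul, div_eq_inv_mul, ← smul_smul _ (b q),
        ← smul_smul _ (-b y), ← smul_smul _ (b q * a y - b y * a q),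
        ← smul_add, ← hkey y q, neg_smul, ← sub_eq_add_neg]
    rw [heq] at hmem
    exact (div_le_one hpos).1 (hP.le_one_of_smul_mem hv hmem)
  set T := {x ∈ vertices P | 0 < b x} with hT
  have hTfin : T.Finite := hP.finite_vertices.subset (Set.sep_subset _ _)
  have hTne : T.Nonempty := by
    obtain ⟨z, hz, hbz⟩ := hP.exists_vertex_pos hm0
    exact ⟨z, hz, by rwa [hmb] at hbz⟩
  obtain ⟨q, ⟨hq, hbq⟩, hmax⟩ := Set.exists_max_image T (fun x => (a x - 1) / b x) hTfin hTne
  refine ⟨q, ⟨hv, hq, ?_, -(N⁻¹ • v) + ((a q - 1) / b q) • m, ?_, ?_, ?_⟩, hbq⟩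
  · rintro rfl
    simp [hb, cross_self] at hbq
  all_goals
    have hform : ∀ x, (-(N⁻¹ • v) + ((a q - 1) / b q) • m) ⬝ᵥ x
        = -a x + (a q - 1) / b q * b x := by
      intro x
      rw [add_dotProduct, neg_dotProduct, smul_dotProduct, smul_dotProduct, hmb, smul_eq_mul,
        smul_eq_mul, ← div_eq_inv_mul]
  · rw [hP.mem_dual]
    intro x hx
    rw [hform]
    rcases lt_trichotomy (b x) 0 with h | h | h
    · have := hcmp x hx q hq h hbq
      rw [div_mul_eq_mul_div, ← sub_le_iff_le_add', le_div_iff₀ hbq]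
      linarith
    · rw [h]; linarith [hle x hx h]
    · have := hmax x ⟨hx, h⟩
      rw [div_le_iff₀ h] at this
      linarith
  · rw [hform]
    have h1 : a v = 1 := div_self hN.ne'
    have h2 : b v = 0 := by simp [hb, cross_self]
    rw [h1, h2]; ring
  · rw [hform]
    field_simp
    ring

open MeasureTheory

/-! ### Volume-preserving linear maps and moments -/

lemma measurePreserving_of_abs_det {n : ℕ} (f : (Fin n → ℝ) ≃ₗ[ℝ] (Fin n → ℝ))
    (hf : |LinearMap.det (f : (Fin n → ℝ) →ₗ[ℝ] (Fin n → ℝ))| = 1) :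
    MeasurePreserving f volume volume := by
  refine ⟨f.toContinuousLinearEquiv.continuous.measurable, ?_⟩
  have h0 : LinearMap.det (f : (Fin n → ℝ) →ₗ[ℝ] (Fin n → ℝ)) ≠ 0 := by
    intro h; rw [h] at hf; simp at hf
  have := Real.map_linearMap_volume_pi_eq_smul_volume_pi h0
  rw [abs_inv, hf] at this
  simpa using this

lemma measurableEmbedding_linearEquiv {n : ℕ} (f : (Fin n → ℝ) ≃ₗ[ℝ] (Fin n → ℝ)) :
    MeasurableEmbedding f :=
  f.toContinuousLinearEquiv.toHomeomorph.measurableEmbedding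

lemma measurePreserving_dualEquiv {n : ℕ} (σ : GL (Fin n) ℤ) :
    MeasurePreserving (dualEquiv σ) volume volume := by
  apply measurePreserving_of_abs_det
  have h : (dualEquiv σ : (Fin n → ℝ) →ₗ[ℝ] (Fin n → ℝ))
      = Matrix.toLin' (((σ : Matrix (Fin n) (Fin n) ℤ).map (Int.cast : ℤ → ℝ)).transpose) := by
    ext1 i
    ext1
    simp only [LinearMap.comp_apply, Matrix.toLin'_apply, Matrix.mulVec_transpose]
    rfl
  have hd : ((σ : Matrix (Fin n) (Fin n) ℤ).map (Int.cast : ℤ → ℝ)).det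
      = (((σ : Matrix (Fin n) (Fin n) ℤ).det : ℤ) : ℝ) :=
    ((Int.castRingHom ℝ).map_det (σ : Matrix (Fin n) (Fin n) ℤ)).symm
  rw [h, LinearMap.det_toLin', Matrix.det_transpose, hd]
  have hu : IsUnit (σ : Matrix (Fin n) (Fin n) ℤ).det :=
    (Matrix.isUnit_iff_isUnit_det _).1 σ.isUnit
  rcases Int.isUnit_iff.1 hu with h | h <;> rw [h] <;> simp

/-- The first moment of an invariant set is invariant. -/
lemma dualMap_integral {n : ℕ} (σ : GL (Fin n) ℤ) {A : Set (Fin n → ℝ)}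
    (hA : ∀ u, dualMap σ u ∈ A ↔ u ∈ A) : dualMap σ (∫ x in A, x) = ∫ x in A, x := by
  have h1 := (measurePreserving_dualEquiv σ).setIntegral_preimage_emb
    (measurableEmbedding_linearEquiv _) (fun x => x) A
  have h2 : dualEquiv σ ⁻¹' A = A := by ext u; exact hA u
  rw [h2] at h1
  have h3 := (dualEquiv σ).toContinuousLinearEquiv.integral_comp_comm (μ := volume.restrict A)
    (fun x => x)
  exact h3.symm.trans h1

lemma integrableOn_id_of_bounded {n : ℕ} {A : Set (Fin n → ℝ)} (hA : Bornology.IsBounded A) :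
    IntegrableOn (fun x : Fin n → ℝ => x) A := by
  have hc : IsCompact (closure A) := hA.isCompact_closure
  exact (continuous_id.continuousOn.integrableOn_compact hc).mono_set subset_closure

lemma dot_integral {n : ℕ} {A : Set (Fin n → ℝ)} (hA : Bornology.IsBounded A) (m : Fin n → ℝ) :
    m ⬝ᵥ (∫ x in A, x) = ∫ x in A, m ⬝ᵥ x :=
  ((dotL m).integral_comp_comm (integrableOn_id_of_bounded hA)).symm

/-- Let `K` be a convex body whose first moment vanishes in the direction of the functional `m`,
and let `R` be a linear reflection changing the sign of `m`. If `R` maps the positive half of `K`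
into `K`, then it maps the negative half of `K` into `K`. -/
lemma reflection_mem {n : ℕ} {K : Set (Fin n → ℝ)} (hc : Convex ℝ K) (hcl : IsClosed K)
    (hb : Bornology.IsBounded K) (hint : (interior K).Nonempty) {m e : Fin n → ℝ}
    (hme : m ⬝ᵥ e = 1) (h0 : ∫ x in K, m ⬝ᵥ x = 0)
    (hpos : ∀ u ∈ K, 0 < m ⬝ᵥ u → u - (2 * (m ⬝ᵥ u)) • e ∈ K) {z : Fin n → ℝ} (hz : z ∈ K)
    (hzm : m ⬝ᵥ z < 0) : z - (2 * (m ⬝ᵥ z)) • e ∈ K := by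
  set R : (Fin n → ℝ) ≃ₗ[ℝ] (Fin n → ℝ) :=
    Module.reflection (f := (2 : ℝ) • (dotL m).toLinearMap) (x := e) (by simp [hme]) with hR
  have hRx : ∀ x, R x = x - (2 * (m ⬝ᵥ x)) • e := by
    intro x
    simp [hR, Module.reflection_apply]
  have hmR : ∀ x, m ⬝ᵥ R x = - (m ⬝ᵥ x) := by
    intro x
    rw [hRx, dotProduct_sub, dotProduct_smul, hme, smul_eq_mul]; ring
  have hRR : ∀ x, R (R x) = x := by
    intro x
    rw [hRx (R x), hmR, hRx]
    module
  have hdet : |LinearMap.det (R : (Fin n → ℝ) →ₗ[ℝ] (Fin n → ℝ))| = 1 := by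
    have h1 : (R : (Fin n → ℝ) →ₗ[ℝ] (Fin n → ℝ)) * (R : (Fin n → ℝ) →ₗ[ℝ] (Fin n → ℝ)) = 1 :=
      LinearMap.ext fun x => hRR x
    have h2 := congrArg LinearMap.det h1
    rw [map_mul, map_one, ← abs_mul_abs_self] at h2
    rcases mul_self_eq_one_iff.1 h2 with h | h
    · exact h
    · have := abs_nonneg (LinearMap.det (R : (Fin n → ℝ) →ₗ[ℝ] (Fin n → ℝ)))
      rw [h] at this; norm_num at this
  have hmp := measurePreserving_of_abs_det R hdet
  have hemb := measurableEmbedding_linearEquiv R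
  have hcont : Continuous fun x : Fin n → ℝ => m ⬝ᵥ x := (dotL m).continuous
  have hRcont : Continuous R := R.toContinuousLinearEquiv.continuous
  have hKint : IntegrableOn (fun x => m ⬝ᵥ x) K :=
    hcont.continuousOn.integrableOn_compact (Metric.isCompact_of_isClosed_isBounded hcl hb)
  set A := K ∩ {x | 0 < m ⬝ᵥ x} with hA
  have hAm : MeasurableSet A := hcl.measurableSet.inter (isOpen_lt continuous_const hcont).measurableSet
  set C := K \ A with hC
  have hCm : MeasurableSet C := hcl.measurableSet.diff hAm
  have hAK : A ⊆ K := Set.inter_subset_left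
  set D := R ⁻¹' A with hD
  have hDm : MeasurableSet D := hRcont.measurable hAm
  have hDC : D ⊆ C := by
    intro x hx
    have hx' : R x ∈ K ∧ 0 < m ⬝ᵥ R x := hx
    refine ⟨?_, fun h => ?_⟩
    · have := hpos _ hx'.1 hx'.2
      rwa [← hRx, hRR] at this
    · have h1 : 0 < m ⬝ᵥ x := h.2
      have h2 := hx'.2
      rw [hmR] at h2
      linarith
  have e1 : ∫ x in C, m ⬝ᵥ x = - ∫ x in A, m ⬝ᵥ x := by
    rw [hC, setIntegral_sdiff hAm hKint hAK, h0, zero_sub]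
  have e2 : ∫ x in D, m ⬝ᵥ x = - ∫ x in A, m ⬝ᵥ x := by
    rw [← hmp.setIntegral_preimage_emb hemb (fun x => m ⬝ᵥ x) A, ← integral_neg]
    simp only [hmR, neg_neg, hD]
  have hCint : IntegrableOn (fun x => m ⬝ᵥ x) C := hKint.mono_set Set.sdiff_subset
  have e3 : ∫ x in C \ D, -(m ⬝ᵥ x) = 0 := by
    rw [integral_neg, setIntegral_sdiff hDm hCint hDC, e1, e2]; simp
  by_contra hzR
  rw [← hRx] at hzR
  have hopen : IsOpen ({x | m ⬝ᵥ x < 0} ∩ R ⁻¹' Kᶜ) :=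
    (isOpen_lt hcont continuous_const).inter (hcl.isOpen_compl.preimage hRcont)
  have hzcl : z ∈ closure (interior K) := by
    rw [hc.closure_interior_eq_closure_of_nonempty_interior hint]
    exact subset_closure hz
  obtain ⟨y, hy⟩ := mem_closure_iff.1 hzcl _ hopen ⟨hzm, hzR⟩
  have hU : IsOpen (({x | m ⬝ᵥ x < 0} ∩ R ⁻¹' Kᶜ) ∩ interior K) := hopen.inter isOpen_interior
  have hpos' : 0 < ∫ x in C \ D, -(m ⬝ᵥ x) := by
    rw [setIntegral_pos_iff_support_of_nonneg_ae]
    · refine (hU.measure_pos volume ⟨y, hy⟩).trans_le (measure_mono ?_)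
      rintro x ⟨⟨hx1, hx2⟩, hx3⟩
      have hx1' : m ⬝ᵥ x < 0 := hx1
      refine ⟨?_, ⟨interior_subset hx3, fun h => ?_⟩, fun h => hx2 (hAK h)⟩
      · rw [Function.mem_support]
        exact (neg_pos.2 hx1').ne'
      · exact absurd hx1' (not_lt.2 (le_of_lt h.2))
    · refine (ae_restrict_iff' (hCm.diff hDm)).2 (Filter.Eventually.of_forall fun x hx => ?_)
      have h1 : ¬ (0 < m ⬝ᵥ x) := fun h => hx.1.2 ⟨hx.1.1, h⟩
      simpa using h1
    · exact (hCint.mono_set Set.sdiff_subset).neg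
  exact hpos'.ne' e3

/-- The Kähler-Einstein condition in terms of moments. -/
lemma IsFano.barycenter_dual_eq_zero_iff {n : ℕ} {P : Set (Fin n → ℝ)} (hP : IsFano P) :
    barycenter (dual P) = 0 ↔ ∫ x in dual P, x = 0 := by
  have h : volume.real (dual P) ≠ 0 := by
    have h1 : 0 < volume (dual P) :=
      Measure.measure_pos_of_nonempty_interior _ ⟨0, hP.zero_mem_interior_dual⟩
    exact (ENNReal.toReal_pos h1.ne' hP.dual_bounded.measure_lt_top.ne).ne'
  unfold barycenter
  rw [smul_eq_zero, or_iff_right (inv_ne_zero h)]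

lemma IsKahlerEinstein.reflection_mem {n : ℕ} {P : Set (Fin n → ℝ)} (hP : IsKahlerEinstein P)
    {m e : Fin n → ℝ} (hme : m ⬝ᵥ e = 1)
    (hpos : ∀ u ∈ dual P, 0 < m ⬝ᵥ u → u - (2 * (m ⬝ᵥ u)) • e ∈ dual P) {z : Fin n → ℝ}
    (hz : z ∈ dual P) (hzm : m ⬝ᵥ z < 0) : z - (2 * (m ⬝ᵥ z)) • e ∈ dual P := by
  refine FanoPolytope.reflection_mem dual_convex dual_closed hP.isFano.dual_bounded
    ⟨0, hP.isFano.zero_mem_interior_dual⟩ hme ?_ hpos hz hzm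
  rw [← dot_integral hP.isFano.dual_bounded,
    hP.isFano.barycenter_dual_eq_zero_iff.1 hP.barycenter_dual, dotProduct_zero]

/-! ### Kähler-Einstein polygons -/

/-- Consecutive vertices `p`, `v`, `q` of a Kähler-Einstein polygon: the barycenters of the cones
over the two edges at `v` span an angle smaller than `π`. -/
lemma IsKahlerEinstein.cross_lt (hP : IsKahlerEinstein P) {p v q : Fin 2 → ℝ}
    (hp : IsEdge P v p) (hq : IsEdge P v q) (hγ : 0 < cross p v) (hα : 0 < cross v q) :
    cross q p < cross p v + cross v q := by
  by_contra! hβ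
  have hF := hP.isFano
  obtain ⟨hv, hpV, -, u₁, hu₁, h1v, h1p⟩ := hp
  obtain ⟨-, hqV, -, u₂, hu₂, h2v, h2q⟩ := hq
  have hv0 := hF.vertex_ne_zero hv
  set d : Fin 2 → ℝ := ![v 1, -v 0] with hd
  have hdx : ∀ x, d ⬝ᵥ x = cross x v := by
    intro x; simp only [dot_eq, hd, cross]; simp; ring
  have hdv : d ⬝ᵥ v = 0 := by rw [hdx, cross_self]
  have hdp : d ⬝ᵥ p = cross p v := hdx p
  have hdq : d ⬝ᵥ q = - cross v q := by rw [hdx, cross_swap]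
  have hd0 : d ≠ 0 := by
    intro h; rw [h, zero_dotProduct] at hdp; linarith
  have hperp : ∀ y : Fin 2 → ℝ, y ⬝ᵥ v = 0 → ∃ c : ℝ, y = c • d := fun y hy =>
    exists_smul_of_dot_eq_zero (u := v) hv0 hd0 (by rw [dotProduct_comm, hdv])
      (by rw [dotProduct_comm, hy])
  set α := cross v q with hαd
  set γ := cross p v with hγd
  set β := cross q p with hβd
  have hrel : ∀ u : Fin 2 → ℝ, α * (u ⬝ᵥ p) + β * (u ⬝ᵥ v) + γ * (u ⬝ᵥ q) = 0 := fun u =>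
    dot_cross_relation u p v q
  have hpK : ∀ u ∈ dual P, -1 ≤ u ⬝ᵥ p := fun u hu => hu p (vertices_subset hpV)
  have hqK : ∀ u ∈ dual P, -1 ≤ u ⬝ᵥ q := fun u hu => hu q (vertices_subset hqV)
  have hvK : ∀ u ∈ dual P, u ⬝ᵥ v ≤ 1 := by
    intro u hu
    have h1 := hpK u hu
    have h2 := hqK u hu
    have h3 := hrel u
    have h4 : β * (u ⬝ᵥ v) ≤ β * 1 := by nlinarith
    exact le_of_mul_le_mul_left h4 (by linarith)
  -- the edge of the dual polygon
  obtain ⟨l, hl⟩ := hperp (u₂ - u₁) (by rw [sub_dotProduct, h1v, h2v, sub_self])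
  have hl_eq : l * (α * γ) = α + β + γ := by
    have h1 := congrArg (fun x => x ⬝ᵥ q) hl
    simp only [sub_dotProduct, smul_dotProduct, h2q, hdq, smul_eq_mul] at h1
    have h2 := hrel u₁
    rw [h1p, h1v] at h2
    linear_combination γ * h1 + h2
  have hu₂' : u₂ = u₁ + l • d := by rw [← hl]; abel
  -- the central section of the dual polygon
  set S : Set ℝ := {t | t • d ∈ dual P} with hS
  have hSicc : S ⊆ Set.Icc (-(1 / γ)) (1 / α) := by
    intro t ht
    have h1 := hpK _ ht
    have h2 := hqK _ ht
    rw [smul_dotProduct, hdp, smul_eq_mul] at h1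
    rw [smul_dotProduct, hdq, smul_eq_mul] at h2
    constructor
    · rw [← neg_div, div_le_iff₀ hγ]; exact h1
    · rw [le_div_iff₀ hα]; linarith
  have hScl : IsClosed S := dual_closed.preimage (by fun_prop : Continuous fun t : ℝ => t • d)
  have hSc : IsCompact S := isCompact_Icc.of_isClosed_subset hScl hSicc
  have hS0 : (0 : ℝ) ∈ S := by
    simp only [hS, Set.mem_ofPred_eq, zero_smul]
    exact interior_subset hF.zero_mem_interior_dual
  obtain ⟨t₀, ht₀, hmin⟩ := hSc.exists_isLeast ⟨0, hS0⟩
  obtain ⟨t₁, ht₁, hmax⟩ := hSc.exists_isGreatest ⟨0, hS0⟩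
  have hlen : t₁ - t₀ < l := by
    have h1 := (hSicc ht₀).1
    have h2 := (hSicc ht₁).2
    have h3 : l = 1 / α + 1 / γ + β / (α * γ) := by
      field_simp; linarith
    have h4 : 0 < β / (α * γ) := div_pos (by linarith) (by positivity)
    linarith
  have h00 : t₀ ≤ 0 := hmin hS0
  have h01 : 0 ≤ t₁ := hmax hS0
  have hl0 : 0 < l := by linarith
  set e := t₀ • d - u₁ with he
  have hve : v ⬝ᵥ e = 1 := by
    rw [dotProduct_comm, he, sub_dotProduct, smul_dotProduct, hdv, h1v]; simp
  have hposK : ∀ u ∈ dual P, 0 < v ⬝ᵥ u → u - (2 * (v ⬝ᵥ u)) • e ∈ dual P := by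
    intro u hu hpos
    set h := v ⬝ᵥ u with hh
    have hle : h ≤ 1 := by rw [hh, dotProduct_comm]; exact hvK u hu
    obtain ⟨t, ht⟩ := hperp (u - h • e - t₀ • d) (by
      rw [sub_dotProduct, sub_dotProduct, smul_dotProduct, smul_dotProduct, hdv,
        dotProduct_comm e v, hve, dotProduct_comm u v, ← hh]; simp)
    have hu_eq : u = t₀ • d + h • e + t • d := by rw [← ht]; abel
    have hh1 : 0 < 1 + h := by linarith
    have hlow : t₀ ≤ t₀ + t / (1 + h) := by
      apply hmin
      have hmem : (1 / (1 + h)) • u + (h / (1 + h)) • u₁ ∈ dual P :=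
        dual_convex hu hu₁ (by positivity) (by positivity) (by field_simp)
      have heq : (1 / (1 + h)) • u + (h / (1 + h)) • u₁ = (t₀ + t / (1 + h)) • d := by
        rw [hu_eq, he]; ext i; simp; field_simp; ring
      rwa [heq] at hmem
    have hup : t₀ + (t + h * l) / (1 + h) ≤ t₁ := by
      apply hmax
      have hmem : (1 / (1 + h)) • u + (h / (1 + h)) • u₂ ∈ dual P :=
        dual_convex hu hu₂ (by positivity) (by positivity) (by field_simp)
      have heq : (1 / (1 + h)) • u + (h / (1 + h)) • u₂
          = (t₀ + (t + h * l) / (1 + h)) • d := by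
        rw [hu_eq, he, hu₂']; ext i; simp; field_simp; ring
      rwa [heq] at hmem
    have ht0 : 0 ≤ t := by
      have : 0 ≤ t / (1 + h) := by linarith
      rcases div_nonneg_iff.1 this with h' | h'
      · exact h'.1
      · linarith [h'.2]
    have hup' : t + h * l ≤ (t₁ - t₀) * (1 + h) := by
      rw [← div_le_iff₀ hh1]; linarith
    set L := (1 - h) * (t₁ - t₀) + h * l with hL
    have hLpos : 0 < L := by
      have : 0 ≤ (1 - h) * (t₁ - t₀) := mul_nonneg (by linarith) (by linarith)
      have : 0 < h * l := mul_pos hpos hl0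
      linarith
    have htL : t ≤ L := by nlinarith
    have hA : (1 - h) • (t₀ • d) + h • u₁ ∈ dual P :=
      dual_convex ht₀ hu₁ (by linarith) hpos.le (by ring)
    have hB : (1 - h) • (t₁ • d) + h • u₂ ∈ dual P :=
      dual_convex ht₁ hu₂ (by linarith) hpos.le (by ring)
    have hmem := dual_convex hA hB (a := 1 - t / L) (b := t / L)
      (by rw [sub_nonneg, div_le_one hLpos]; exact htL) (by positivity) (by ring)
    have heq : (1 - t / L) • ((1 - h) • (t₀ • d) + h • u₁)
        + (t / L) • ((1 - h) • (t₁ • d) + h • u₂) = u - (2 * h) • e := by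
      have hsplit : (1 - h) • (t₁ • d) + h • u₂ = (1 - h) • (t₀ • d) + h • u₁ + L • d := by
        rw [hu₂', hL]; module
      have htd : (t / L) • (L • d) = t • d := by
        rw [smul_smul, div_mul_cancel₀ _ hLpos.ne']
      rw [hsplit, smul_add (t / L), htd, hu_eq, he]
      module
    rwa [heq] at hmem
  have hvu₂ : v ⬝ᵥ u₂ = -1 := by rw [dotProduct_comm, h2v]
  have hR := hP.reflection_mem hve hposK hu₂ (by rw [hvu₂]; norm_num)
  have hmid := dual_convex hR hu₂ (a := 1 / 2) (b := 1 / 2) (by norm_num) (by norm_num)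
    (by norm_num)
  have heq : (1 / 2 : ℝ) • (u₂ - (2 * (v ⬝ᵥ u₂)) • e) + (1 / 2 : ℝ) • u₂ = (t₀ + l) • d := by
    rw [hvu₂, he, hu₂']; module
  rw [heq] at hmid
  have := hmax hmid
  linarith

lemma IsKahlerEinstein.zero_mem_interior_B (hP : IsKahlerEinstein P) :
    (0 : Fin 2 → ℝ) ∈ interior (B P) := by
  have hF := hP.isFano
  rw [hF.B_eq]
  apply zero_mem_interior_convexHull
  intro f hf
  by_contra hf0
  have hedge : ∀ p q, IsEdge P p q → 0 ≤ f ⬝ᵥ p + f ⬝ᵥ q := by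
    intro p q h
    obtain ⟨w, hw, c, hc, hpq⟩ := hF.exists_coneBarycenter h
    rw [← dotProduct_add, hpq, dotProduct_smul]
    exact mul_nonneg hc.le (hf w hw)
  obtain ⟨z, hz, hfz⟩ := hF.exists_vertex_neg hf0
  obtain ⟨v, hv, hmin⟩ := Set.exists_min_image _ (fun x => f ⬝ᵥ x) hF.finite_vertices ⟨z, hz⟩
  have hfv : f ⬝ᵥ v < 0 := (hmin z hz).trans_lt hfz
  obtain ⟨q, hq, hα⟩ := hF.exists_edge hv (ε := 1) one_ne_zero
  obtain ⟨p, hp, hγ⟩ := hF.exists_edge hv (ε := -1) (by norm_num)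
  rw [one_mul] at hα
  rw [neg_one_mul, ← cross_swap] at hγ
  have h1 := hP.cross_lt hp hq hγ hα
  have h2 := dot_cross_relation f p v q
  have h3 := hedge _ _ hp
  have h4 := hedge _ _ hq
  nlinarith

lemma IsKahlerEinstein.B_isFano (hP : IsKahlerEinstein P) : IsFano (B P) :=
  hP.isFano.B_isFano hP.zero_mem_interior_B

/-! ### Kähler-Einstein triangles -/

lemma IsKahlerEinstein.cross_le_of_triangle (hP : IsKahlerEinstein P) {v₁ v₂ v₃ : Fin 2 → ℝ}
    (hV : vertices P = {v₁, v₂, v₃}) (hα : 0 < cross v₂ v₃) (hβ : 0 < cross v₃ v₁)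
    (hγ : 0 < cross v₁ v₂) : cross v₃ v₁ ≤ cross v₂ v₃ := by
  by_contra! hlt
  have hF := hP.isFano
  have hK : ∀ u, u ∈ dual P ↔ -1 ≤ u ⬝ᵥ v₁ ∧ -1 ≤ u ⬝ᵥ v₂ ∧ -1 ≤ u ⬝ᵥ v₃ := by
    intro u
    rw [hF.mem_dual, hV]
    simp
  set d : Fin 2 → ℝ := ![-v₃ 1, v₃ 0] with hd
  have hdx : ∀ x, d ⬝ᵥ x = cross v₃ x := by
    intro x; simp only [dot_eq, hd, cross]; simp; ring
  set α := cross v₂ v₃ with hαd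
  set β := cross v₃ v₁ with hβd
  set γ := cross v₁ v₂ with hγd
  have hd1 : d ⬝ᵥ v₁ = β := hdx v₁
  have hd2 : d ⬝ᵥ v₂ = -α := by rw [hdx, cross_swap]
  have hd3 : d ⬝ᵥ v₃ = 0 := by rw [hdx, cross_self]
  have hrel : ∀ u : Fin 2 → ℝ, α * (u ⬝ᵥ v₁) + β * (u ⬝ᵥ v₂) + γ * (u ⬝ᵥ v₃) = 0 := fun u =>
    dot_cross_relation u v₁ v₂ v₃
  set m : Fin 2 → ℝ := (2 * α * β)⁻¹ • (β • v₂ - α • v₁) with hm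
  have hmu : ∀ u, m ⬝ᵥ u = (β * (u ⬝ᵥ v₂) - α * (u ⬝ᵥ v₁)) / (2 * α * β) := by
    intro u
    rw [hm, dotProduct_comm, dotProduct_smul, dotProduct_sub, dotProduct_smul, dotProduct_smul]
    simp only [smul_eq_mul]
    rw [div_eq_inv_mul]
  have hme : m ⬝ᵥ (-d) = 1 := by
    rw [hmu, neg_dotProduct, neg_dotProduct, hd1, hd2]; field_simp; ring
  have hmem : ∀ u, u - (2 * (m ⬝ᵥ u)) • (-d) ∈ dual P ↔
      -α ≤ β * (u ⬝ᵥ v₂) ∧ -β ≤ α * (u ⬝ᵥ v₁) ∧ -1 ≤ u ⬝ᵥ v₃ := by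
    intro u
    rw [hK]
    simp only [sub_dotProduct, smul_dotProduct, neg_dotProduct, hd1, hd2, hd3, smul_eq_mul]
    have e1 : u ⬝ᵥ v₁ - 2 * (m ⬝ᵥ u) * -β = β * (u ⬝ᵥ v₂) / α := by
      rw [hmu]; field_simp; ring
    have e2 : u ⬝ᵥ v₂ - 2 * (m ⬝ᵥ u) * -(-α) = α * (u ⬝ᵥ v₁) / β := by
      rw [hmu]; field_simp; ring
    rw [e1, e2, le_div_iff₀ hα, le_div_iff₀ hβ]
    simp
  have hpos : ∀ u ∈ dual P, 0 < m ⬝ᵥ u → u - (2 * (m ⬝ᵥ u)) • (-d) ∈ dual P := by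
    intro u hu h
    rw [hmem]
    obtain ⟨h1, h2, h3⟩ := (hK u).1 hu
    rw [hmu, div_pos_iff_of_pos_right (by positivity)] at h
    refine ⟨?_, ?_, h3⟩ <;> nlinarith
  obtain ⟨q, ⟨-, hq, hne, z, hz, hz2, hzq⟩, hcq⟩ :=
    hF.exists_edge (v := v₂) (by rw [hV]; simp) (ε := 1) one_ne_zero
  rw [one_mul] at hcq
  have hq3 : q = v₃ := by
    rw [hV] at hq
    rcases hq with rfl | rfl | rfl
    · rw [cross_swap] at hcq; linarith
    · exact absurd rfl hne
    · rfl
  rw [hq3] at hzq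
  have hz1 := hrel z
  rw [hz2, hzq] at hz1
  have hneg : m ⬝ᵥ z < 0 := by
    rw [hmu, hz2]
    exact div_neg_of_neg_of_pos (by nlinarith) (by positivity)
  have := (hmem z).1 (hP.reflection_mem hme hpos hz hneg)
  rw [hz2] at this
  linarith [this.1]

/-- The vertices of a Kähler-Einstein triangle sum to zero, and any two of them span an edge. -/
lemma IsKahlerEinstein.exists_of_triangle (hP : IsKahlerEinstein P) (hT : IsTriangle P) :
    ∃ v₁ v₂ v₃, vertices P = {v₁, v₂, v₃} ∧ v₁ + v₂ + v₃ = 0 ∧ IsEdge P v₁ v₂ ∧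
      IsEdge P v₂ v₃ ∧ IsEdge P v₃ v₁ := by
  have hF := hP.isFano
  obtain ⟨z, hz⟩ : (vertices P).Nonempty := by
    rw [← Set.ncard_pos hF.finite_vertices, hT]; norm_num
  obtain ⟨q, hq, hα⟩ := hF.exists_edge hz (ε := 1) one_ne_zero
  obtain ⟨p, hp, hγ⟩ := hF.exists_edge hz (ε := -1) (by norm_num)
  rw [one_mul] at hα
  rw [neg_one_mul, ← cross_swap] at hγ
  have hpq : p ≠ q := by
    rintro rfl; rw [cross_swap] at hα; linarith
  have hV : vertices P = {p, z, q} := by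
    symm
    apply Set.eq_of_subset_of_ncard_le
    · rintro x (rfl | rfl | rfl)
      exacts [hp.2.1, hz, hq.2.1]
    · rw [hT, Set.ncard_eq_three.2 ⟨p, z, q, hp.2.2.1.symm, hpq, hq.2.2.1, rfl⟩]
    · exact hF.finite_vertices
  obtain ⟨x, hx, hβ⟩ := hF.exists_edge hq.2.1 (ε := 1) one_ne_zero
  rw [one_mul] at hβ
  have hxp : x = p := by
    have h := hx.2.1
    rw [hV] at h
    rcases h with rfl | rfl | rfl
    · rfl
    · rw [cross_swap] at hβ; linarith
    · exact absurd rfl hx.2.2.1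
  rw [hxp] at hx hβ
  have h1 := hP.cross_le_of_triangle hV hα hβ hγ
  have h2 := hP.cross_le_of_triangle (v₁ := z) (v₂ := q) (v₃ := p)
    (by rw [hV]; ext; simp; tauto) hβ hγ hα
  have h3 := hP.cross_le_of_triangle (v₁ := q) (v₂ := p) (v₃ := z)
    (by rw [hV]; ext; simp; tauto) hγ hα hβ
  refine ⟨p, z, q, hV, ?_, hp.symm, hq, hx⟩
  have h4 := cross_relation p z q
  have e1 : cross q p = cross z q := by linarith
  have e2 : cross p z = cross z q := by linarith
  rw [e1, e2, ← smul_add, ← smul_add] at h4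
  exact (smul_eq_zero.1 h4).resolve_left hα.ne'

lemma IsKahlerEinstein.B_eq_neg (hP : IsKahlerEinstein P) (hT : IsTriangle P) : B P = -P := by
  have hF := hP.isFano
  obtain ⟨v₁, v₂, v₃, hV, hsum, h12, h23, h31⟩ := hP.exists_of_triangle hT
  have hprim : ∀ v ∈ vertices P, IsPrimitive (-v) := fun v hv => (hF.primitive_vertices v hv).neg
  have hW : coneBarycenters P = -(vertices P) := by
    ext w
    constructor
    · rintro ⟨hw, p, q, hpq, c, hc, h⟩
      have hr : ∃ r ∈ vertices P, p + q = -r := by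
        obtain ⟨hp, hq, hne, -⟩ := hpq
        rw [hV] at hp hq
        have e1 : v₁ + v₂ = -v₃ := eq_neg_of_add_eq_zero_left hsum
        have e2 : v₂ + v₃ = -v₁ := by
          apply eq_neg_of_add_eq_zero_left; rw [← hsum]; abel
        have e3 : v₃ + v₁ = -v₂ := by
          apply eq_neg_of_add_eq_zero_left; rw [← hsum]; abel
        rw [hV]
        rcases hp with rfl | rfl | rfl <;> rcases hq with rfl | rfl | rfl
        · exact absurd rfl hne
        · exact ⟨_, by simp, e1⟩
        · refine ⟨_, ?_, (add_comm _ _).trans e3⟩; simp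
        · refine ⟨_, ?_, (add_comm _ _).trans e1⟩; simp
        · exact absurd rfl hne
        · exact ⟨_, by simp, e2⟩
        · exact ⟨_, by simp, e3⟩
        · refine ⟨_, ?_, (add_comm _ _).trans e2⟩; simp
        · exact absurd rfl hne
      obtain ⟨r, hr, hpqr⟩ := hr
      have : w = -r := hw.eq_of_smul (hprim r hr) hc one_pos (by rw [one_smul, ← h, hpqr])
      rw [this]
      simpa using hr
    · intro hw
      have hw' : -w ∈ vertices P := hw
      have hwp : IsPrimitive w := by simpa using hprim _ hw'
      have hex : ∃ p q, IsEdge P p q ∧ p + q = w := by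
        rw [hV] at hw'
        rcases hw' with h | h | h
        · exact ⟨_, _, h23, by rw [← neg_neg w, h]; apply eq_neg_of_add_eq_zero_left; rw [← hsum]; abel⟩
        · exact ⟨_, _, h31, by rw [← neg_neg w, h]; apply eq_neg_of_add_eq_zero_left; rw [← hsum]; abel⟩
        · exact ⟨_, _, h12, by rw [← neg_neg w, h]; exact eq_neg_of_add_eq_zero_left hsum⟩
      obtain ⟨p, q, hpq, h⟩ := hex
      exact ⟨hwp, p, q, hpq, 1, one_pos, by rw [h, one_smul]⟩
  rw [hF.B_eq, hW, convexHull_neg, ← hF.eq_convexHull]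

lemma vertices_neg {n : ℕ} (Q : Set (Fin n → ℝ)) : vertices (-Q) = -vertices Q := by
  have := image_extremePoints (𝕜 := ℝ) (LinearEquiv.neg ℝ (M := Fin n → ℝ)) Q
  simpa [vertices, ← Set.image_neg_eq_neg] using this.symm

lemma dual_neg {n : ℕ} (Q : Set (Fin n → ℝ)) : dual (-Q) = -dual Q := by
  ext u
  simp only [dual, Set.mem_ofPred_eq, Set.mem_neg, neg_dotProduct]
  constructor
  · intro h v hv
    simpa using h (-v) (by simpa using hv)
  · intro h v hv
    simpa using h (-v) hv

lemma isTriangle_neg (hT : IsTriangle P) : IsTriangle (-P) := by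
  unfold IsTriangle at *
  rw [vertices_neg, ← Set.image_neg_eq_neg, Set.ncard_image_of_injective _ neg_injective, hT]

lemma IsKahlerEinstein.neg_of_triangle (hP : IsKahlerEinstein P) (hT : IsTriangle P) :
    IsKahlerEinstein (-P) := by
  have hF : IsFano (-P) := hP.B_eq_neg hT ▸ hP.B_isFano
  refine ⟨hF, ?_⟩
  rw [hF.barycenter_dual_eq_zero_iff, dual_neg]
  have h0 := hP.isFano.barycenter_dual_eq_zero_iff.1 hP.barycenter_dual
  have h1 := (MeasureTheory.Measure.measurePreserving_neg
    (MeasureTheory.volume : MeasureTheory.Measure (Fin 2 → ℝ))).setIntegral_preimage_emb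
    (MeasurableEquiv.neg (Fin 2 → ℝ)).measurableEmbedding (fun x => x) (dual P)
  rw [h0, MeasureTheory.integral_neg, neg_eq_zero] at h1
  exact h1

/-! ### Automorphisms and invariant functionals -/

/-- No nonzero functional is invariant under all automorphisms of `P`. -/
def NoInvariantFunctional {n : ℕ} (P : Set (Fin n → ℝ)) : Prop :=
  ∀ u : Fin n → ℝ, (∀ σ : GL (Fin n) ℤ, IsAutomorphism P σ → dualMap σ u = u) → u = 0

section General

variable {n : ℕ} {P : Set (Fin n → ℝ)}

lemma IsAutomorphism.dualMap_mem_iff {σ : GL (Fin n) ℤ} (h : IsAutomorphism P σ)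
    {u : Fin n → ℝ} : dualMap σ u ∈ dual P ↔ u ∈ dual P :=
  ⟨fun hu => by simpa using h.inv.dualMap_mem hu, h.dualMap_mem⟩

lemma IsFano.isKahlerEinstein (hP : IsFano P) (h : NoInvariantFunctional P) :
    IsKahlerEinstein P :=
  ⟨hP, hP.barycenter_dual_eq_zero_iff.2
    (h _ fun σ hσ => dualMap_integral σ fun _ => hσ.dualMap_mem_iff)⟩

lemma IsFano.isSymmetric (hP : IsFano P) (h : NoInvariantFunctional P) : IsSymmetric P := by
  refine ⟨hP, fun x _ _ hfix => ?_⟩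
  by_contra hx0
  set A := dual P ∩ {u | 0 < x ⬝ᵥ u} with hA
  have hcont : Continuous fun u : Fin n → ℝ => x ⬝ᵥ u := (dotL x).continuous
  have hAm : MeasurableSet A :=
    dual_closed.measurableSet.inter (isOpen_lt continuous_const hcont).measurableSet
  have hAb : Bornology.IsBounded A := hP.dual_bounded.subset Set.inter_subset_left
  have h0 : ∫ u in A, u = 0 := by
    refine h _ fun σ hσ => dualMap_integral σ fun u => ?_
    simp only [hA, Set.mem_inter_iff, hσ.dualMap_mem_iff, Set.mem_ofPred_eq]
    rw [dotProduct_comm, dualMap_dot, hfix σ hσ, dotProduct_comm]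
  have h1 : 0 < ∫ u in A, x ⬝ᵥ u := by
    have hU : IsOpen (interior (dual P) ∩ {u | 0 < x ⬝ᵥ u}) :=
      isOpen_interior.inter (isOpen_lt continuous_const hcont)
    rw [setIntegral_pos_iff_support_of_nonneg_ae]
    · refine (hU.measure_pos volume ?_).trans_le (measure_mono ?_)
      · obtain ⟨ε, hε, hmem⟩ := exists_smul_mem
          (by rw [interior_interior]; exact hP.zero_mem_interior_dual :
            (0 : Fin n → ℝ) ∈ interior (interior (dual P))) x
        refine ⟨ε • x, hmem, ?_⟩
        have hxx : 0 < x ⬝ᵥ x :=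
          lt_of_le_of_ne (Finset.sum_nonneg fun i _ => mul_self_nonneg _)
            (fun h => hx0 (dotProduct_self_eq_zero.1 h.symm))
        simp only [Set.mem_ofPred_eq, dotProduct_smul, smul_eq_mul]
        positivity
      · rintro u ⟨hu1, hu2⟩
        exact ⟨(show 0 < x ⬝ᵥ u from hu2).ne', interior_subset hu1, hu2⟩
    · exact (ae_restrict_iff' hAm).2 (Filter.Eventually.of_forall fun u hu =>
        le_of_lt (show 0 < x ⬝ᵥ u from hu.2))
    · exact (dotL x).integrable_comp (integrableOn_id_of_bounded hAb)
  rw [← dot_integral hAb, h0, dotProduct_zero] at h1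
  exact lt_irrefl _ h1

lemma isAutomorphism_neg_one_iff : IsAutomorphism P (-1) ↔ -P = P := by
  unfold IsAutomorphism
  rw [← Set.image_neg_eq_neg]
  simp only [unimodularMap_neg_one]

lemma dualMap_neg_one (u : Fin n → ℝ) : dualMap (-1) u = -u :=
  eq_of_forall_dot_eq fun x => by
    rw [dualMap_dot, unimodularMap_neg_one, dotProduct_neg, neg_dotProduct]

lemma noInvariantFunctional_of_neg (h : IsAutomorphism P (-1)) : NoInvariantFunctional P := by
  intro u hu
  have := hu _ h
  rw [dualMap_neg_one] at this
  exact self_eq_neg.1 this.symm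

end General

lemma IsEdge.map {p q : Fin 2 → ℝ} (h : IsEdge P p q) {σ : GL (Fin 2) ℤ}
    (hσ : IsAutomorphism P σ) : IsEdge P (unimodularMap σ p) (unimodularMap σ q) := by
  obtain ⟨hp, hq, hpq, u, hu, h1, h2⟩ := h
  refine ⟨hσ.mem_vertices hp, hσ.mem_vertices hq, fun h => hpq ?_, dualMap σ⁻¹ u,
    hσ.inv.dualMap_mem hu, ?_, ?_⟩
  · simpa using congrArg (unimodularMap σ⁻¹) h
  · rw [dualMap_dot, unimodularMap_apply_inv, h1]
  · rw [dualMap_dot, unimodularMap_apply_inv, h2]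

lemma IsAutomorphism.mem_coneBarycenters {σ : GL (Fin 2) ℤ} (hσ : IsAutomorphism P σ)
    {w : Fin 2 → ℝ} (hw : w ∈ coneBarycenters P) : unimodularMap σ w ∈ coneBarycenters P := by
  obtain ⟨hw, p, q, hpq, c, hc, h⟩ := hw
  exact ⟨hw.unimodularMap σ, _, _, hpq.map hσ, c, hc,
    by rw [← unimodularMap_add, h, unimodularMap_smul]⟩

lemma IsFano.isAutomorphism_B (hP : IsFano P) {σ : GL (Fin 2) ℤ} (hσ : IsAutomorphism P σ) :
    IsAutomorphism (B P) σ := by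
  have hW : unimodularEquiv σ '' coneBarycenters P = coneBarycenters P := by
    apply Set.Subset.antisymm
    · rintro _ ⟨w, hw, rfl⟩
      exact hσ.mem_coneBarycenters hw
    · intro w hw
      exact ⟨unimodularMap σ⁻¹ w, hσ.inv.mem_coneBarycenters hw, by simp⟩
  have h := (unimodularEquiv σ : (Fin 2 → ℝ) →ₗ[ℝ] (Fin 2 → ℝ)).image_convexHull (coneBarycenters P)
  have h2 : (unimodularEquiv σ : (Fin 2 → ℝ) →ₗ[ℝ] (Fin 2 → ℝ)) '' coneBarycenters P
    = coneBarycenters P := hW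
  rw [h2, ← hP.B_eq] at h
  exact h

lemma IsFano.noInvariantFunctional_B (hP : IsFano P) (h : NoInvariantFunctional P) :
    NoInvariantFunctional (B P) :=
  fun u hu => h u fun σ hσ => hu σ (hP.isAutomorphism_B hσ)

/-! ### Symmetric polygons with an invariant functional -/

/-- If `P` is symmetric, an invariant functional attains its maximum on an edge whose endpoints
are exchanged by an automorphism and have a primitive sum. -/
lemma IsSymmetric.exists_max_edge (hP : IsSymmetric P) {u : Fin 2 → ℝ} (hu0 : u ≠ 0)
    (hinv : ∀ σ : GL (Fin 2) ℤ, IsAutomorphism P σ → dualMap σ u = u) :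
    ∃ v v', v ∈ vertices P ∧ v' ∈ vertices P ∧ v ≠ v' ∧ u ⬝ᵥ v' = u ⬝ᵥ v ∧ 0 < u ⬝ᵥ v ∧
      (∀ x ∈ vertices P, u ⬝ᵥ x ≤ u ⬝ᵥ v) ∧
      (∀ x ∈ vertices P, u ⬝ᵥ x = u ⬝ᵥ v → x = v ∨ x = v') ∧ IsPrimitive (v + v') ∧
      (∀ σ, IsAutomorphism P σ → unimodularMap σ (v + v') = v + v') ∧
      ∃ σ, IsAutomorphism P σ ∧ unimodularMap σ v = v' := by
  have hF := hP.isFano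
  have hdot : ∀ σ, IsAutomorphism P σ → ∀ x, u ⬝ᵥ unimodularMap σ x = u ⬝ᵥ x := by
    intro σ hσ x
    rw [← dualMap_dot, hinv σ hσ]
  obtain ⟨z, hz, hzu⟩ := hF.exists_vertex_pos hu0
  obtain ⟨v, hv, hmax⟩ := Set.exists_max_image _ (fun x => u ⬝ᵥ x) hF.finite_vertices ⟨z, hz⟩
  have hpos : 0 < u ⬝ᵥ v := hzu.trans_le (hmax z hz)
  have hex : ∃ σ, IsAutomorphism P σ ∧ unimodularMap σ v ≠ v := by
    by_contra! h
    exact hF.vertex_ne_zero hv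
      (hP.eq_zero_of_fixed v (vertices_subset hv) (hF.isLatticePoint_vertex hv) h)
  obtain ⟨σ, hσ, hσv⟩ := hex
  set v' := unimodularMap σ v with hv'
  have hv'V : v' ∈ vertices P := hσ.mem_vertices hv
  have hv'u : u ⬝ᵥ v' = u ⬝ᵥ v := hdot σ hσ v
  have hall : ∀ x ∈ vertices P, u ⬝ᵥ x = u ⬝ᵥ v → x = v ∨ x = v' := fun x hx h =>
    eq_or_eq_of_dot_eq hu0 hv hv'V hx (Ne.symm hσv) hv'u.symm h.symm
  have hfix : ∀ τ, IsAutomorphism P τ → unimodularMap τ (v + v') = v + v' := by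
    intro τ hτ
    rw [unimodularMap_add]
    have hne : unimodularMap τ v ≠ unimodularMap τ v' := fun h =>
      hσv (by simpa using (congrArg (unimodularMap τ⁻¹) h).symm)
    rcases hall _ (hτ.mem_vertices hv) (hdot τ hτ v) with h1 | h1 <;>
    rcases hall _ (hτ.mem_vertices hv'V) ((hdot τ hτ v').trans hv'u) with h2 | h2
    · exact absurd (h1.trans h2.symm) hne
    · rw [h1, h2]
    · rw [h1, h2, add_comm]
    · exact absurd (h1.trans h2.symm) hne
  refine ⟨v, v', hv, hv'V, Ne.symm hσv, hv'u, hpos, hmax, hall, ?_, hfix, σ, hσ, rfl⟩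
  have hne : v + v' ≠ 0 := by
    intro h
    have := congrArg (fun x => u ⬝ᵥ x) h
    simp only [dotProduct_add, dotProduct_zero] at this
    linarith
  obtain ⟨w, hw, c, hc, hcw⟩ :=
    ((hF.isLatticePoint_vertex hv).add (hF.isLatticePoint_vertex hv'V)).exists_primitive hne
  have hc1 : c = 1 := by
    by_contra hc1
    have hc2 : (2 : ℝ) ≤ c := by exact_mod_cast (by omega : 2 ≤ c)
    have hmid : (1 / 2 : ℝ) • v + (1 / 2 : ℝ) • v' ∈ P :=
      hF.convex (vertices_subset hv) (vertices_subset hv'V) (by norm_num) (by norm_num)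
        (by norm_num)
    have hwP : w ∈ P := by
      have := hF.convex hF.zero_mem hmid (a := 1 - 2 / c) (b := 2 / c)
        (by rw [sub_nonneg, div_le_one (by linarith)]; exact hc2) (by positivity) (by ring)
      have e : (1 - 2 / (c : ℝ)) • (0 : Fin 2 → ℝ)
          + (2 / (c : ℝ)) • ((1 / 2 : ℝ) • v + (1 / 2 : ℝ) • v') = w := by
        rw [smul_zero, zero_add, ← smul_add, hcw, smul_smul, smul_smul]
        rw [show 2 / (c : ℝ) * (1 / 2) * c = 1 by field_simp, one_smul]
      rwa [e] at this
    refine hw.ne_zero (hP.eq_zero_of_fixed w hwP hw.isLatticePoint fun τ hτ => ?_)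
    have := hfix τ hτ
    rw [hcw, unimodularMap_smul] at this
    exact smul_right_injective _ (by linarith : (c : ℝ) ≠ 0) this
  rw [hcw, hc1]
  simpa using hw

lemma IsFano.lt_two_of_add_eq_smul (hP : IsFano P) {z x y : Fin 2 → ℝ} (hz : z ∈ vertices P)
    (hx : x ∈ P) (hy : y ∈ P) (hxz : x ≠ z) {a : ℝ} (h : x + y = a • z) : a < 2 := by
  by_contra! ha
  have hmid : (1 / 2 : ℝ) • x + (1 / 2 : ℝ) • y ∈ P :=
    hP.convex hx hy (by norm_num) (by norm_num) (by norm_num)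
  have hle : a / 2 ≤ 1 := by
    apply hP.le_one_of_smul_mem hz
    have e : (a / 2) • z = (1 / 2 : ℝ) • x + (1 / 2 : ℝ) • y := by
      rw [← smul_add, h, smul_smul]; congr 1; ring
    rwa [e]
  have ha2 : a = 2 := by linarith
  refine hxz (eq_of_vertex_comb (t := 1 / 2) hz hx hy (by norm_num) (by norm_num) ?_).1
  rw [show (1 - 1 / 2 : ℝ) = 1 / 2 by norm_num, ← smul_add, h, ha2, smul_smul]
  norm_num

/-- A symmetric polygon with an invariant functional `u` is a trapezoid: it has two edges on which
`u` is constant, with opposite sums, and no further vertices. -/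
lemma IsSymmetric.exists_trapezoid (hP : IsSymmetric P) {u : Fin 2 → ℝ} (hu0 : u ≠ 0)
    (hinv : ∀ σ : GL (Fin 2) ℤ, IsAutomorphism P σ → dualMap σ u = u) :
    ∃ v v' p p', vertices P = {v, v', p, p'} ∧ v ≠ v' ∧ p ≠ p' ∧ p + p' = -(v + v') ∧
      0 < u ⬝ᵥ v ∧ u ⬝ᵥ v' = u ⬝ᵥ v ∧ u ⬝ᵥ p = -(u ⬝ᵥ v) ∧ u ⬝ᵥ p' = -(u ⬝ᵥ v) ∧
      ∃ σ, IsAutomorphism P σ ∧ unimodularMap σ v = v' ∧ unimodularMap σ v' = v ∧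
        unimodularMap σ p = p' ∧ unimodularMap σ p' = p := by
  have hF := hP.isFano
  have hdot : ∀ σ, IsAutomorphism P σ → ∀ x, u ⬝ᵥ unimodularMap σ x = u ⬝ᵥ x := by
    intro σ hσ x
    rw [← dualMap_dot, hinv σ hσ]
  obtain ⟨v, v', hv, hv', hvv, hv'u, hpos, hmax, hall, hprim, hfix, σ, hσ, hσv⟩ :=
    hP.exists_max_edge hu0 hinv
  obtain ⟨p, p', hp, hp', hpp, hp'u, hppos, hpmax, hpall, hpprim, hpfix, -⟩ :=
    hP.exists_max_edge (neg_ne_zero.2 hu0) (fun τ hτ => by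
      have := map_neg (dualEquiv τ) u
      simp only [dualEquiv_apply, hinv τ hτ] at this
      exact this)
  simp only [neg_dotProduct, neg_inj, neg_le_neg_iff, neg_pos] at hp'u hppos hpmax hpall
  have hσv' : unimodularMap σ v' = v := by
    have := hfix σ hσ
    rw [unimodularMap_add, hσv, add_comm v v'] at this
    exact add_left_cancel this
  set w := v + v' with hw
  have huw : u ⬝ᵥ w = 2 * (u ⬝ᵥ v) := by rw [hw, dotProduct_add, hv'u]; ring
  have hcross : cross w (v - v') ≠ 0 := by
    intro h
    obtain ⟨c, hc⟩ := exists_smul_of_cross_eq_zero hprim.ne_zero h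
    have h1 := congrArg (fun x => u ⬝ᵥ x) hc
    simp only [dotProduct_sub, dotProduct_smul, hv'u, sub_self, huw, smul_eq_mul] at h1
    have hc0 : c = 0 := by
      rcases mul_eq_zero.1 h1.symm with h | h
      · exact h
      · linarith
    rw [hc0, zero_smul] at hc
    exact hvv (sub_eq_zero.1 hc)
  have hfixed : ∀ x, unimodularMap σ x = x → ∃ s : ℝ, x = s • w := by
    intro x hx
    obtain ⟨s, t, hst⟩ := exists_comb hcross x
    refine ⟨s, ?_⟩
    have h1 : unimodularMap σ (v - v') = -(v - v') := by
      have := map_sub (unimodularEquiv σ) v v'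
      simp only [unimodularEquiv_apply, hσv, hσv'] at this
      rw [this]; abel
    rw [hst, unimodularMap_add, unimodularMap_smul, unimodularMap_smul, hfix σ hσ, h1] at hx
    have h2 : (2 * t) • (v - v') = 0 := by
      have := add_left_cancel hx
      rw [smul_neg] at this
      rw [mul_smul, two_smul]
      nth_rewrite 1 [← this]
      simp
    have h3 : t = 0 := by
      rcases smul_eq_zero.1 h2 with h | h
      · linarith
      · exact absurd (sub_eq_zero.1 h) hvv
    rw [hst, h3, zero_smul, add_zero]
  have hpw : p + p' = -w := by
    obtain ⟨s, hs⟩ := hfixed _ (hpfix σ hσ)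
    have h1 := congrArg (fun x => u ⬝ᵥ x) hs
    simp only [dotProduct_add, dotProduct_smul, huw, hp'u, smul_eq_mul] at h1
    have hs0 : s < 0 := by
      by_contra! h
      nlinarith
    refine hpprim.eq_of_smul hprim.neg one_pos (neg_pos.2 hs0) ?_
    rw [one_smul, hs]; simp
  have hup : u ⬝ᵥ p = -(u ⬝ᵥ v) := by
    have h1 := congrArg (fun x => u ⬝ᵥ x) hpw
    simp only [dotProduct_add, dotProduct_neg, huw, hp'u] at h1
    linarith
  have hσp : unimodularMap σ p = p' := by
    rcases hpall _ (hσ.mem_vertices hp) (hdot σ hσ p) with h | h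
    · exfalso
      obtain ⟨s, hs⟩ := hfixed _ h
      have hs' : p' = (-1 - s) • w := by
        rw [eq_sub_of_add_eq' hpw, hs]; module
      have h1 := hp'u
      rw [hs', hs, dotProduct_smul, dotProduct_smul, huw, smul_eq_mul, smul_eq_mul] at h1
      have h2 : -1 - s = s := mul_right_cancel₀ (by linarith : 2 * (u ⬝ᵥ v) ≠ 0) h1
      exact hpp (by rw [hs', h2, hs])
    · exact h
  have hσp' : unimodularMap σ p' = p := by
    have := hpfix σ hσ
    rw [unimodularMap_add, hσp, add_comm p p'] at this
    exact add_left_cancel this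
  have hother : ∀ z ∈ vertices P, z ≠ v → z ≠ v' → z ≠ p → z ≠ p' →
      u ⬝ᵥ z = 0 ∧ -z ∈ vertices P := by
    intro z hz h1 h2 h3 h4
    have hlt : u ⬝ᵥ z < u ⬝ᵥ v := lt_of_le_of_ne (hmax z hz) fun h =>
      (hall z hz h).elim h1 h2
    have hgt : u ⬝ᵥ p < u ⬝ᵥ z := lt_of_le_of_ne (hpmax z hz) fun h =>
      (hpall z hz h.symm).elim h3 h4
    have hσσ : ∀ x ∈ vertices P, unimodularMap σ (unimodularMap σ x) = x := by
      intro x _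
      obtain ⟨a, b, rfl⟩ := exists_comb hcross x
      have h1 : unimodularMap σ (v - v') = -(v - v') := by
        have := map_sub (unimodularEquiv σ) v v'
        simp only [unimodularEquiv_apply, hσv, hσv'] at this
        rw [this]; abel
      have h2 : unimodularMap σ (-(v - v')) = v - v' := by
        have := map_neg (unimodularEquiv σ) (v - v')
        simp only [unimodularEquiv_apply, h1, neg_neg] at this
        exact this
      simp only [unimodularMap_add, unimodularMap_smul, hfix σ hσ, h1, h2]
    obtain ⟨s, hs⟩ := hfixed (z + unimodularMap σ z) (by
      rw [unimodularMap_add, hσσ z hz, add_comm])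
    have hzl := hF.isLatticePoint_vertex hz
    obtain ⟨m, hm⟩ := hprim.exists_int (c := s) (hs ▸ hzl.add (hzl.unimodularMap σ))
    have e1 := congrArg (fun x => u ⬝ᵥ x) hs
    simp only [dotProduct_add, dotProduct_smul, huw, hdot σ hσ, smul_eq_mul] at e1
    have hs1 : s < 1 := by by_contra! h; nlinarith
    have hs2 : -1 < s := by by_contra! h; nlinarith
    rw [hm] at hs1 hs2
    have hm0 : m = 0 := by
      have a1 : m < 1 := by exact_mod_cast hs1
      have a2 : -1 < m := by exact_mod_cast hs2
      omega
    rw [hm, hm0] at hs e1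
    refine ⟨by rw [Int.cast_zero, zero_mul] at e1; linarith, ?_⟩
    rw [Int.cast_zero, zero_smul] at hs
    rw [neg_eq_of_add_eq_zero_right hs]
    exact hσ.mem_vertices hz
  refine ⟨v, v', p, p', ?_, hvv, hpp, hpw, hpos, hv'u, hup, hp'u.trans hup, σ, hσ, hσv, hσv',
    hσp, hσp'⟩
  apply Set.Subset.antisymm
  swap
  · rintro x (rfl | rfl | rfl | rfl) <;> assumption
  intro z hz
  by_contra hzn
  simp only [Set.mem_insert_iff, Set.mem_singleton_iff, not_or] at hzn
  obtain ⟨hz1, hz2, hz3, hz4⟩ := hzn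
  obtain ⟨huz, hnz⟩ := hother z hz hz1 hz2 hz3 hz4
  have hzprim := hF.primitive_vertices z hz
  have hvP := vertices_subset hv
  have hint : ∀ q ∈ vertices P, u ⬝ᵥ q = -(u ⬝ᵥ v) →
      ∃ a : ℤ, v + q = (a : ℝ) • z ∧ -1 ≤ a ∧ a ≤ 1 := by
    intro q hq huq
    obtain ⟨a, ha⟩ := exists_smul_of_dot_eq_zero (x := v + q) hu0 hzprim.ne_zero huz
      (by rw [dotProduct_add, huq]; ring)
    obtain ⟨m, rfl⟩ := hzprim.exists_int (c := a)
      (ha ▸ (hF.isLatticePoint_vertex hv).add (hF.isLatticePoint_vertex hq))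
    have h1 := hF.lt_two_of_add_eq_smul hz hvP (vertices_subset hq) (Ne.symm hz1) ha
    have h2 := hF.lt_two_of_add_eq_smul (a := -m) hnz hvP (vertices_subset hq)
      (by rintro h; rw [h, dotProduct_neg, huz] at hpos; simp at hpos) (by rw [ha]; simp)
    have h1' : m < 2 := by exact_mod_cast h1
    have h2' : -m < 2 := by exact_mod_cast h2
    exact ⟨m, ha, by omega, by omega⟩
  obtain ⟨a, ha, ha1, ha2⟩ := hint p hp hup
  obtain ⟨b, hb, hb1, hb2⟩ := hint p' hp' (hp'u.trans hup)
  have hab : a ≠ b := by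
    rintro rfl
    exact hpp (add_left_cancel (ha.trans hb.symm))
  have hab' : a ≠ -b := by
    rintro rfl
    have h1 : (v + p) + (v + p') = 0 := by rw [ha, hb]; simp
    have h2 : v - v' = 0 := by
      rw [← h1]
      have : (v + p) + (v + p') = v + v + (p + p') := by abel
      rw [this, hpw, hw]; abel
    exact hvv (sub_eq_zero.1 h2)
  have hcases : (p = -v ∧ p' = -v') ∨ (p' = -v ∧ p = -v') := by
    have h0 : a = 0 ∨ b = 0 := by omega
    rcases h0 with h | h
    · left
      rw [h, Int.cast_zero, zero_smul] at ha
      have e := eq_neg_of_add_eq_zero_right ha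
      refine ⟨e, ?_⟩
      rw [eq_sub_of_add_eq' hpw, e, hw]; abel
    · right
      rw [h, Int.cast_zero, zero_smul] at hb
      have e := eq_neg_of_add_eq_zero_right hb
      refine ⟨e, ?_⟩
      rw [eq_sub_of_add_eq hpw, e, hw]; abel
  have hnegV : ∀ x ∈ vertices P, -x ∈ vertices P := by
    intro x hx
    by_cases h1 : x = v
    · rcases hcases with ⟨h, h'⟩ | ⟨h, h'⟩ <;> rw [h1, ← h] <;> assumption
    by_cases h2 : x = v'
    · rcases hcases with ⟨h, h'⟩ | ⟨h, h'⟩ <;> rw [h2, ← h'] <;> assumption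
    by_cases h3 : x = p
    · rcases hcases with ⟨h, h'⟩ | ⟨h, h'⟩
      · rw [h3, h, neg_neg]; exact hv
      · rw [h3, h', neg_neg]; exact hv'
    by_cases h4 : x = p'
    · rcases hcases with ⟨h, h'⟩ | ⟨h, h'⟩
      · rw [h4, h', neg_neg]; exact hv'
      · rw [h4, h, neg_neg]; exact hv
    exact (hother x hx h1 h2 h3 h4).2
  have hnegP : -P = P := by
    have hVV : -vertices P = vertices P := by
      ext x
      exact ⟨fun h => by simpa using hnegV _ h, fun h => hnegV x h⟩
    rw [hF.eq_convexHull, ← convexHull_neg, hVV]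
  have h1 := hinv _ (isAutomorphism_neg_one_iff.2 hnegP)
  rw [dualMap_neg_one] at h1
  exact hu0 (self_eq_neg.1 h1.symm)

lemma IsSymmetric.B_of_invariant (hP : IsSymmetric P) {u : Fin 2 → ℝ} (hu0 : u ≠ 0)
    (hinv : ∀ σ : GL (Fin 2) ℤ, IsAutomorphism P σ → dualMap σ u = u) :
    IsFano (B P) ∧ NoInvariantFunctional (B P) := by
  have hF := hP.isFano
  obtain ⟨v, v', p, p', hV, hvv, hpp, hsum, hpos, huv', hup, hup', σ, hσ, hσv, hσv', hσp, hσp'⟩ :=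
    hP.exists_trapezoid hu0 hinv
  have hvV : v ∈ vertices P := by rw [hV]; simp
  have hv'V : v' ∈ vertices P := by rw [hV]; simp
  have hpV : p ∈ vertices P := by rw [hV]; simp
  have hp'V : p' ∈ vertices P := by rw [hV]; simp
  have hbd : ∀ x ∈ vertices P, u ⬝ᵥ x ≤ u ⬝ᵥ v ∧ -(u ⬝ᵥ v) ≤ u ⬝ᵥ x := by
    intro x hx
    rw [hV] at hx
    rcases hx with h | h | h | h <;> rw [h] <;> constructor <;> linarith
  have hE1 : IsEdge P v v' := by
    refine ⟨hvV, hv'V, hvv, -((u ⬝ᵥ v)⁻¹ • u), ?_, ?_, ?_⟩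
    · rw [hF.mem_dual]
      intro x hx
      rw [neg_dotProduct, smul_dotProduct, smul_eq_mul, neg_le_neg_iff, ← div_eq_inv_mul,
        div_le_one hpos]
      exact (hbd x hx).1
    · rw [neg_dotProduct, smul_dotProduct, smul_eq_mul, inv_mul_cancel₀ hpos.ne']
    · rw [neg_dotProduct, smul_dotProduct, smul_eq_mul, huv', inv_mul_cancel₀ hpos.ne']
  have hE2 : IsEdge P p p' := by
    refine ⟨hpV, hp'V, hpp, (u ⬝ᵥ v)⁻¹ • u, ?_, ?_, ?_⟩
    · rw [hF.mem_dual]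
      intro x hx
      rw [smul_dotProduct, smul_eq_mul, ← div_eq_inv_mul, le_div_iff₀ hpos]
      linarith [(hbd x hx).2]
    · rw [smul_dotProduct, smul_eq_mul, hup, mul_neg, inv_mul_cancel₀ hpos.ne']
    · rw [smul_dotProduct, smul_eq_mul, hup', mul_neg, inv_mul_cancel₀ hpos.ne']
  have hp'eq : p' = -(v + v') - p := eq_sub_of_add_eq' hsum
  have hopp : ∀ x y, IsEdge P x y → ∃ x' y', IsEdge P x' y' ∧ x' + y' = -(x + y) := by
    intro x y hxy
    have hmap := hxy.map hσ
    have hx := hxy.1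
    have hy := hxy.2.1
    have hne := hxy.2.2.1
    rw [hV] at hx hy
    rcases hx with hx | hx | hx | hx <;> rcases hy with hy | hy | hy | hy <;>
      rw [hx, hy] at hmap hne ⊢ <;>
      first
      | exact absurd rfl hne
      | exact ⟨_, _, hE1, by rw [hp'eq]; abel1⟩
      | exact ⟨_, _, hE2, by rw [hp'eq]; abel1⟩
      | exact ⟨_, _, hmap, by simp only [hσv, hσv', hσp, hσp']; rw [hp'eq]; abel1⟩
  have hWneg : ∀ w ∈ coneBarycenters P, -w ∈ coneBarycenters P := by
    rintro w ⟨hw, x, y, hxy, c, hc, h⟩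
    obtain ⟨x', y', hxy', h'⟩ := hopp x y hxy
    exact ⟨hw.neg, x', y', hxy', c, hc, by rw [h', h, smul_neg]⟩
  refine ⟨hF.B_isFano ?_, noInvariantFunctional_of_neg (isAutomorphism_neg_one_iff.2 ?_)⟩
  · rw [hF.B_eq]
    apply zero_mem_interior_convexHull
    intro f hf
    have hedge : ∀ x y, IsEdge P x y → f ⬝ᵥ (x + y) = 0 := by
      intro x y hxy
      obtain ⟨w, hw, c, hc, h⟩ := hF.exists_coneBarycenter hxy
      have h1 := hf w hw
      have h2 := hf _ (hWneg w hw)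
      rw [dotProduct_neg] at h2
      rw [h, dotProduct_smul, le_antisymm (by linarith) h1, smul_zero]
    obtain ⟨q, hq, hqv', huq⟩ : ∃ q, IsEdge P v q ∧ q ≠ v' ∧ u ⬝ᵥ q = -(u ⬝ᵥ v) := by
      obtain ⟨q₁, hq₁, hc₁⟩ := hF.exists_edge hvV (ε := 1) one_ne_zero
      obtain ⟨q₂, hq₂, hc₂⟩ := hF.exists_edge hvV (ε := -1) (by norm_num)
      have hval : ∀ q, IsEdge P v q → q ≠ v' → u ⬝ᵥ q = -(u ⬝ᵥ v) := by
        intro q hq hqv'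
        have h := hq.2.1
        rw [hV] at h
        rcases h with h | h | h | h
        · exact absurd h.symm hq.2.2.1
        · exact absurd h hqv'
        · rw [h, hup]
        · rw [h, hup']
      by_cases h : q₁ = v'
      · have h' : q₂ ≠ v' := by
          rintro h'
          rw [h] at hc₁
          rw [h'] at hc₂
          linarith
        exact ⟨q₂, hq₂, h', hval q₂ hq₂ h'⟩
      · exact ⟨q₁, hq₁, h, hval q₁ hq₁ h⟩
    have hww : v + v' ≠ 0 := hE1.add_ne_zero
    refine eq_zero_of_dot_eq_zero (v := v + v') (w := v + q) ?_ (hedge _ _ hE1) (hedge _ _ hq)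
    intro h
    obtain ⟨c, hc⟩ := exists_smul_of_cross_eq_zero hww h
    have h1 := congrArg (fun x => u ⬝ᵥ x) hc
    simp only [dotProduct_add, dotProduct_smul, smul_eq_mul, huq, huv'] at h1
    have hc0 : c = 0 := by
      have : c * (u ⬝ᵥ v + u ⬝ᵥ v) = 0 := by rw [← h1]; ring
      rcases mul_eq_zero.1 this with h | h
      · exact h
      · linarith
    rw [hc0, zero_smul] at hc
    exact hq.add_ne_zero hc
  · have hW : -coneBarycenters P = coneBarycenters P := by
      ext x
      exact ⟨fun h => by simpa using hWneg _ h, fun h => hWneg x h⟩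
    rw [hF.B_eq, ← convexHull_neg, hW]

lemma IsSymmetric.B_isFano (hP : IsSymmetric P) :
    IsFano (B P) ∧ NoInvariantFunctional (B P) := by
  by_cases h : NoInvariantFunctional P
  · exact ⟨(hP.isFano.isKahlerEinstein h).B_isFano, hP.isFano.noInvariantFunctional_B h⟩
  · unfold NoInvariantFunctional at h
    push Not at h
    obtain ⟨u, hinv, hu0⟩ := h
    exact hP.B_of_invariant hu0 hinv

lemma iterate_B_isFano (hP : IsFano P) (h : NoInvariantFunctional P) (k : ℕ) :
    IsFano (B^[k] P) ∧ NoInvariantFunctional (B^[k] P) := by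
  induction k with
  | zero => exact ⟨hP, h⟩
  | succ k ih =>
    rw [Function.iterate_succ_apply']
    exact ⟨(ih.1.isKahlerEinstein ih.2).B_isFano, ih.1.noInvariantFunctional_B ih.2⟩

lemma IsKahlerEinstein.iterate_of_triangle (hP : IsKahlerEinstein P) (hT : IsTriangle P) (s : ℕ) :
    B^[2 * s] P = P ∧ B^[2 * s + 1] P = -P := by
  have h2 : B^[2] P = P := by
    change B (B P) = P
    rw [hP.B_eq_neg hT, (hP.neg_of_triangle hT).B_eq_neg (isTriangle_neg hT), neg_neg]
  have h : B^[2 * s] P = P := by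
    rw [Function.iterate_mul]
    exact Function.iterate_fixed h2 s
  exact ⟨h, by rw [Function.iterate_succ_apply', h, hP.B_eq_neg hT]⟩

lemma IsKahlerEinstein.isKahlerEinstein_iterate (hP : IsKahlerEinstein P) (hT : IsTriangle P)
    (s : ℕ) : IsKahlerEinstein (B^[s] P) ∧ IsTriangle (B^[s] P) := by
  rcases Nat.even_or_odd' s with ⟨k, rfl | rfl⟩
  · rw [(hP.iterate_of_triangle hT k).1]
    exact ⟨hP, hT⟩
  · rw [(hP.iterate_of_triangle hT k).2]
    exact ⟨hP.neg_of_triangle hT, isTriangle_neg hT⟩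

end FanoPolytope

theorem theorem1p6 (P : Set (Fin 2 → ℝ)) (hP : FanoPolytope.IsFano P) :
    (FanoPolytope.IsKahlerEinstein P → FanoPolytope.IsOfType 1 P) ∧
    (FanoPolytope.IsKahlerEinstein P → FanoPolytope.IsTriangle P →
      FanoPolytope.B P = -P ∧
      (∀ s : ℕ, FanoPolytope.B^[2 * s] P = P ∧ FanoPolytope.B^[2 * s + 1] P = -P) ∧
      FanoPolytope.IsPeriodic 2 P ∧
      FanoPolytope.IsOfTypeInfty P ∧
      (∀ s : ℕ, FanoPolytope.IsKahlerEinstein (FanoPolytope.B^[s] P) ∧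
        FanoPolytope.IsTriangle (FanoPolytope.B^[s] P))) ∧
    (FanoPolytope.IsSymmetric P →
      FanoPolytope.IsSymmetric (FanoPolytope.B P) ∧
      FanoPolytope.IsKahlerEinstein (FanoPolytope.B P) ∧
      FanoPolytope.IsOfTypeInfty P) := by
  refine ⟨fun hK k hk => ?_, fun hK hT => ?_, fun hS => ?_⟩
  · rcases Nat.le_one_iff_eq_zero_or_eq_one.1 hk with rfl | rfl
    · exact hP
    · exact hK.B_isFano
  · refine ⟨hK.B_eq_neg hT, hK.iterate_of_triangle hT, ⟨by norm_num, 0, ?_⟩, fun _ _ k _ => ?_,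
      hK.isKahlerEinstein_iterate hT⟩
    · exact (hK.iterate_of_triangle hT 1).1
    · exact (hK.isKahlerEinstein_iterate hT k).1.isFano
  · obtain ⟨hB, hN⟩ := hS.B_isFano
    refine ⟨hB.isSymmetric hN, hB.isKahlerEinstein hN, fun _ _ k _ => ?_⟩
    cases k with
    | zero => exact hP
    | succ k =>
      rw [Function.iterate_succ_apply]
      exact (FanoPolytope.iterate_B_isFano hB hN k).1
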